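/- All graphs are finite, undirected, simple and connected; $N_G(v)$ is the set of neighbours of $v$ in $G$ and $N^1_G(v)=N_G(v)\cup\{v\}$. Multisets are written $\{\!\{\cdot\}\!\}$, and $\mathsf{hash}$ is a fixed injective function. Each test below refines a colouring $\chi^{(t)}_G$ of the vertex pairs of $G$, $t=0,1,2,\dots$; the stable colour $\chi_G(u,v)$ is the colour of $(u,v)$ after sufficiently many iterations, so that $\chi_G(u,v)=\chi_H(x,y)$ if and only if $\chi^{(t)}_G(u,v)=\chi^{(t)}_H(x,y)$ for all $t$. **SWL tests.** The initial colour is the node mark: $\chi^{(0)}_G(u,v)$ depends only on whether $u=v$. For a set $\mathcal A$ of aggregations, $\chi^{(t+1)}_G(u,v)$ is the hash of $\chi^{(t)}_G(u,v)$ together with the values, for $\chi=\chi_G^{(t)}$, of the aggregations in $\mathcal A$, which are among $$\mathsf L_u=\{\!\{\chi(u,w):w\in N_G(v)\}\!\},\quad \mathsf L_v=\{\!\{\chi(w,v):w\in N_G(u)\}\!\},\quad \mathsf G_v=\{\!\{\chi(w,v):w\in V_G\}\!\},\quad \mathsf P_{vv}=\chi(v,v).$$ The output $c(G)$ is $\{\!\{\{\!\{\chi_G(u,v):v\in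 V_G\}\!\}:u\in V_G\}\!\}$ for the pooling $\mathsf{VS}$, and $\{\!\{\{\!\{\chi_G(u,v):u\in V_G\}\!\}:v\in V_G\}\!\}$ for the pooling $\mathsf{SV}$. For $P\in\{\mathsf{VS},\mathsf{SV}\}$, $\mathsf{SWL}(P)$ uses $\mathcal A=\{\mathsf L_u\}$ and pooling $P$, and $\mathsf{PSWL}(P)$ uses $\mathcal A=\{\mathsf L_u,\mathsf P_{vv}\}$ and pooling $P$; $\mathsf{GSWL}$ uses $\mathcal A=\{\mathsf L_u,\mathsf G_v\}$ and $\mathsf{SSWL}$ uses $\mathcal A=\{\mathsf L_u,\mathsf L_v\}$, both with pooling $\mathsf{VS}$. **FWL tests.** Here $\chi^{(0)}_G(u,v)$ records whether $u=v$, or $u$ and $v$ are adjacent, or neither, and $$\chi^{(t+1)}_G(u,v)=\mathsf{hash}\bigl(\chi^{(t)}_G(u,v),\{\!\{(\chi^{(t)}_G(u,w),\chi^{(t)}_G(w,v)):w\in S\}\!\}\bigr),$$ where $S=N^1_G(v)$ for $\mathsf{LFWL(2)}$, $S=N^1_G(u)\cup N^1_G(v)$ for $\mathsf{SLFWL(2)}$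 and $S=V_G$ for $\mathsf{FWL(2)}$. The output is $c(G)=\{\!\{\chi_G(u,v):u,v\in V_G\}\!\}$. **Comparison.** For tests $\mathsf A_1,\mathsf A_2$ with outputs $c_1,c_2$, write $\mathsf A_2\preceq\mathsf A_1$ if $c_1(G)=c_1(H)$ implies $c_2(G)=c_2(H)$ for all graphs $G,H$; write $\mathsf A_2\prec\mathsf A_1$ if $\mathsf A_2\preceq\mathsf A_1$ but not $\mathsf A_1\preceq\mathsf A_2$; write $\mathsf A_1\nsim\mathsf A_2$ if neither $\mathsf A_1\preceq\mathsf A_2$ nor $\mathsf A_2\preceq\mathsf A_1$. **Theorem.** The following hold: - $\mathsf{SWL(VS)}\prec\mathsf{SWL(SV)}$ and $\mathsf{PSWL(VS)}\prec\mathsf{PSWL(SV)}$; - $\mathsf{SWL(VS)}\prec\mathsf{PSWL(VS)}$ and $\mathsf{SWL(SV)}\prec\mathsf{PSWL(SV)}$; - $\mathsf{PSWL(SV)}\prec\mathsf{GSWL}\prec\mathsf{SSWL}$; - $\mathsf{PSWL(VS)}\prec\mathsf{LFWL(2)}$ and $\mathsf{SSWL}\prec\mathsf{SLFWL(2)}$;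 - $\mathsf{LFWL(2)}\prec\mathsf{SLFWL(2)}\prec\mathsf{FWL(2)}$; - $\mathsf{SWL(SV)}\nsim\mathsf{PSWL(VS)}$; - $\mathsf{LFWL(2)}\nsim\mathsf{SWL(SV)}$, $\mathsf{LFWL(2)}\nsim\mathsf{PSWL(SV)}$, $\mathsf{LFWL(2)}\nsim\mathsf{GSWL}$ and $\mathsf{LFWL(2)}\nsim\mathsf{SSWL}$. -/

import Mathlib

namespace WLHierarchy

noncomputable section

/-- Finite, undirected, simple, connected graphs. -/
structure FinConnGraph where
  V : Type
  [fintypeV : Fintype V]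
  graph : SimpleGraph V
  connected : graph.Connected

attribute [instance] FinConnGraph.fintypeV

namespace FinConnGraph

/-- The set of all vertices. -/
def verts (G : FinConnGraph) : Finset G.V := Finset.univ

open Classical in
/-- The open neighbourhood of `v`. -/
def nbrs (G : FinConnGraph) (v : G.V) : Finset G.V :=
  Finset.univ.filter fun w => G.graph.Adj v w

open Classical in
/-- The vertices at distance at most one from `v`, that is, the neighbours of `v` and `v` itself. -/
def nbrs1 (G : FinConnGraph) (v : G.V) : Finset G.V :=
  insert v (G.nbrs v)

end FinConnGraph

/-- The multiset of the values `f w` for `w` in `S`, counted with multiplicity. -/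
def msetOf {α β : Type} (S : Finset α) (f : α → β) : Multiset β :=
  S.val.map f

/-- A perfect (that is, injective) hash function, with natural numbers as colours. -/
def hash {α : Type} [Encodable α] (a : α) : ℕ :=
  Encodable.encode a

theorem hash_injective {α : Type} [Encodable α] : Function.Injective (hash (α := α)) :=
  Encodable.encode_injective

/-- The eight basic aggregation operations on colourings of vertex pairs:
single-point `Puv`, `Pvu`, `Puu`, `Pvv`, global `Gu`, `Gv` and local `Lu`, `Lv`. -/
inductive Agg where
  | Puv | Pvu | Puu | Pvv | Gu | Gv | Lu | Lv

/-- The value of an aggregation operation at the pair `(u, v)` for the colouring `χ`.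
A single colour is recorded as a one-element multiset. -/
def Agg.eval (G : FinConnGraph) (χ : G.V → G.V → ℕ) (u v : G.V) : Agg → Multiset ℕ
  | .Puv => {χ u v}
  | .Pvu => {χ v u}
  | .Puu => {χ u u}
  | .Pvv => {χ v v}
  | .Gu => msetOf G.verts fun w => χ u w
  | .Gv => msetOf G.verts fun w => χ w v
  | .Lu => msetOf (G.nbrs v) fun w => χ u w
  | .Lv => msetOf (G.nbrs u) fun w => χ w v

open Classical in
/-- The node marking initial colour of `v` in the copy of the graph attached to `u`. -/
def nodeMark (G : FinConnGraph) (u v : G.V) : ℕ :=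
  if u = v then 1 else 0

/-- The colour of `(u, v)` after `t` iterations of the node marking SWL test whose aggregation
scheme consists of `Puv` together with the operations in the list `A`. -/
def swlColor (A : List Agg) (G : FinConnGraph) : ℕ → G.V → G.V → ℕ
  | 0 => nodeMark G
  | t + 1 => fun u v => hash ((Agg.Puv :: A).map (Agg.eval G (swlColor A G t) u v))

open Classical in
/-- The isomorphism type of the ordered pair `(u, v)`: equal, adjacent, or neither. -/
def isoType (G : FinConnGraph) (u v : G.V) : ℕ :=
  if u = v then 0 else if G.graph.Adj u v then 1 else 2

/-- A choice, for every pair `(u, v)`, of the set of vertices `w` over which a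
folklore-type test aggregates. -/
abbrev Range := (G : FinConnGraph) → G.V → G.V → Finset G.V

/-- The multiset of the colour pairs `(χ (u, w), χ (w, v))`, where `w` runs over `S`. -/
def walk (G : FinConnGraph) (u v : G.V) (S : Finset G.V) (χ : G.V → G.V → ℕ) :
    Multiset (ℕ × ℕ) :=
  msetOf S fun w => (χ u w, χ w v)

/-- The colour of `(u, v)` after `t` iterations of the folklore-type test with range `S`. -/
def fwlColor (S : Range) (G : FinConnGraph) : ℕ → G.V → G.V → ℕ
  | 0 => isoType G
  | t + 1 => fun u v => hash (fwlColor S G t u v, walk G u v (S G u v) (fwlColor S G t))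

/-- The stable colour of a pair, given the colours `χ t` at all iterations `t`. It is represented
by the sequence of all colours of the pair, so two pairs (of the same graph or of two graphs) have
the same stable colour iff no iteration tells them apart. As colours only get refined, this is the
same as having equal colours after sufficiently many iterations (`stableColor_eq_iff`). -/
def stableColor {V : Type} (χ : ℕ → V → V → ℕ) (u v : V) : ℕ → ℕ :=
  fun t => χ t u v

theorem swlColor_refines (A : List Agg) (G H : FinConnGraph) (t : ℕ) (u v : G.V) (x y : H.V)
    (h : swlColor A G (t + 1) u v = swlColor A H (t + 1) x y) :
    swlColor A G t u v = swlColor A H t x y := by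
  have h1 := hash_injective h
  simp only [List.map_cons, List.cons.injEq, Agg.eval, Multiset.singleton_inj] at h1
  exact h1.1

theorem fwlColor_refines (S : Range) (G H : FinConnGraph) (t : ℕ) (u v : G.V) (x y : H.V)
    (h : fwlColor S G (t + 1) u v = fwlColor S H (t + 1) x y) :
    fwlColor S G t u v = fwlColor S H t x y :=
  congrArg Prod.fst (hash_injective h)

/-- For colourings that only get refined, equality of stable colours is equality of the colours
after any sufficiently large number of iterations. -/
theorem stableColor_eq_iff {V W : Type} [Finite V] [Finite W] (χ : ℕ → V → V → ℕ)
    (ψ : ℕ → W → W → ℕ)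
    (href : ∀ t u v x y, χ (t + 1) u v = ψ (t + 1) x y → χ t u v = ψ t x y) :
    ∃ T, ∀ t ≥ T, ∀ u v x y, stableColor χ u v = stableColor ψ x y ↔ χ t u v = ψ t x y := by
  classical
  have hdown : ∀ u v x y s t, s ≤ t → χ t u v = ψ t x y → χ s u v = ψ s x y := by
    intro u v x y s t hst
    induction t, hst using Nat.le_induction with
    | base => exact id
    | succ t _ ih => exact fun h => ih (href t u v x y h)
  have hpt : ∀ p : (V × V) × (W × W), ∃ T, χ T p.1.1 p.1.2 = ψ T p.2.1 p.2.2 →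
      ∀ t, χ t p.1.1 p.1.2 = ψ t p.2.1 p.2.2 := by
    intro p
    by_cases h : ∀ t, χ t p.1.1 p.1.2 = ψ t p.2.1 p.2.2
    · exact ⟨0, fun _ => h⟩
    · obtain ⟨T, hT⟩ := not_forall.1 h
      exact ⟨T, fun h' => absurd h' hT⟩
  choose T hT using hpt
  obtain ⟨B, hB⟩ := (Set.finite_range T).bddAbove
  refine ⟨B, fun t ht u v x y => ⟨fun h => congrFun h t, fun h => funext fun s => ?_⟩⟩
  refine hT ((u, v), (x, y)) (hdown u v x y _ t ?_ h) s
  exact (hB ⟨((u, v), (x, y)), rfl⟩).trans ht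

/-- The two pooling paradigms of SWL tests: vertex-subgraph and subgraph-vertex. -/
inductive Pool where
  | VS | SV

/-- The node marking SWL test `A(𝒜, Pool)`, given by the graph representation that it computes.
Nested multisets of stable colours stand for their own hash values. -/
def swl (A : List Agg) (P : Pool) (G : FinConnGraph) : Multiset (Multiset (ℕ → ℕ)) :=
  match P with
  | .VS => msetOf G.verts fun u => msetOf G.verts fun v => stableColor (swlColor A G) u v
  | .SV => msetOf G.verts fun v => msetOf G.verts fun u => stableColor (swlColor A G) u v

/-- The folklore-type test with range `S`, given by the graph representation that it computes. -/
def fwl (S : Range) (G : FinConnGraph) : Multiset (ℕ → ℕ) :=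
  msetOf (G.verts ×ˢ G.verts) fun p => stableColor (fwlColor S G) p.1 p.2

def SWL (P : Pool) := swl [.Lu] P

def PSWL (P : Pool) := swl [.Lu, .Pvv] P

def GSWL := swl [.Lu, .Gv] .VS

def SSWL := swl [.Lu, .Lv] .VS

/-- The localized 2-FWL test. -/
def LFWL2 := fwl fun G _ v => G.nbrs1 v

open Classical in
/-- The symmetrized localized 2-FWL test. -/
def SLFWL2 := fwl fun G u v => G.nbrs1 u ∪ G.nbrs1 v

/-- The standard 2-FWL test. -/
def FWL2 := fwl fun G _ _ => G.verts

/-- `WeakerEq c₂ c₁`: the test `c₁` is more powerful than `c₂` (not necessarily strictly), `c₂ ⪯ c₁`. -/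
def WeakerEq {R₂ R₁ : Type} (c₂ : FinConnGraph → R₂) (c₁ : FinConnGraph → R₁) : Prop :=
  ∀ G H : FinConnGraph, c₁ G = c₁ H → c₂ G = c₂ H

/-- `EquallyPowerful c₁ c₂`: the tests are equally powerful, `c₁ ≃ c₂`. -/
def EquallyPowerful {R₁ R₂ : Type} (c₁ : FinConnGraph → R₁) (c₂ : FinConnGraph → R₂) : Prop :=
  WeakerEq c₁ c₂ ∧ WeakerEq c₂ c₁

/-- `StrictlyWeaker c₂ c₁`: the test `c₁` is strictly more powerful than `c₂`, `c₂ ≺ c₁`. -/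
def StrictlyWeaker {R₂ R₁ : Type} (c₂ : FinConnGraph → R₂) (c₁ : FinConnGraph → R₁) : Prop :=
  WeakerEq c₂ c₁ ∧ ¬ EquallyPowerful c₂ c₁

/-- `Incomparable c₁ c₂`: neither test is more powerful than the other, `c₁ ≁ c₂`. -/
def Incomparable {R₁ R₂ : Type} (c₁ : FinConnGraph → R₁) (c₂ : FinConnGraph → R₂) : Prop :=
  ¬ WeakerEq c₁ c₂ ∧ ¬ WeakerEq c₂ c₁

end

end WLHierarchy

/-! Call a pair of colourings of the vertex pairs of `G` and `H` preserved by a test if equal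
colours imply equal initial colours and equal aggregated values. Such a pair refines every iteration
of the test, and the colours at a late enough iteration are themselves preserved. Hence two outputs
agree if and only if some preserved pair has equal pooled multisets. To prove a comparison, take a
preserved pair for the stronger test, and show that it is also preserved by the weaker test and has
equal multisets under the weaker pooling.

The main tool, `Equitable.msetOf_verts`, is a double count of walks. In a connected graph with an
equitable colouring that marks a root, the number of walks of length `k` from the root to a colour
class is the size of the class times the number of such walks from any one of its vertices back to
the root. Both walk counts are determined by colours, and for a suitable `k` the second one is
positive, so class sizes are determined as well. Applied to rows, this shows that under `Lu` the
colour of `(u, u)` determines the whole row of `u`, so VS pooling only sees the diagonal. Applied to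
columns, it shows that `Lv` determines `Gv`. In the folklore tests, isomorphism types make adjacency
and equality visible in the walk multiset, so `Lu`, `Lv`, `Pvv` and smaller ranges are obtained by
filtering it.

All strictness and incomparability claims follow by transitivity from six separations. Each uses a
Fürer graph, where a base vertex is replaced by the even subsets of its neighbours and subsets over
adjacent base vertices are joined when they agree about the base edge, and its twist, where the
adjacency over one base edge is complemented. The separations are finite computations with a
numerical hash of the colourings. A difference of hash invariants proves that the outputs differ,
because the hash depends only on the true colours. For equality the hash merely suggests a
partition, whose stability is then checked exactly. Collisions can make a check fail but cannot make
it unsound. -/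

namespace WLHierarchy

/-! ### Equal multisets of values as matchings -/

section Multisets

variable {α α' β γ : Type}

theorem rel_of_msetOf_eq {S : Finset α} {T : Finset α'} {f : α → β} {g : α' → β}
    (h : msetOf S f = msetOf T g) : Multiset.Rel (fun s t => f s = g t) S.val T.val := by
  have h' : Multiset.Rel (· = ·) (S.val.map f) (T.val.map g) := Multiset.rel_eq.2 h
  rwa [Multiset.rel_map] at h'

theorem msetOf_eq_of_rel {S : Finset α} {T : Finset α'} {f : α → β} {g : α' → β}
    (h : Multiset.Rel (fun s t => f s = g t) S.val T.val) : msetOf S f = msetOf T g := by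
  have h' : Multiset.Rel (· = ·) (S.val.map f) (T.val.map g) := by rwa [Multiset.rel_map]
  exact Multiset.rel_eq.1 h'

/-- Equality of the multisets gives a matching of `S` with `T` along which `f` and `g` agree. The
same matching serves every coarser pair of functions. -/
theorem msetOf_congr {S : Finset α} {T : Finset α'} {f : α → β} {g : α' → β}
    {f' : α → γ} {g' : α' → γ} (h : msetOf S f = msetOf T g)
    (hc : ∀ s ∈ S, ∀ t ∈ T, f s = g t → f' s = g' t) : msetOf S f' = msetOf T g' :=
  msetOf_eq_of_rel ((rel_of_msetOf_eq h).mono hc)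

theorem rel_filter {r : α → α' → Prop} {p : α → Prop} {q : α' → Prop} [DecidablePred p]
    [DecidablePred q] {s : Multiset α} {t : Multiset α'} (h : Multiset.Rel r s t)
    (hpq : ∀ a b, r a b → (p a ↔ q b)) : Multiset.Rel r (s.filter p) (t.filter q) := by
  induction h with
  | zero => exact Multiset.Rel.zero
  | @cons a b as bs hab _ ih =>
    by_cases hp : p a
    · rw [Multiset.filter_cons_of_pos _ hp, Multiset.filter_cons_of_pos _ ((hpq a b hab).1 hp)]
      exact Multiset.Rel.cons hab ih
    · rwa [Multiset.filter_cons_of_neg _ hp,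
        Multiset.filter_cons_of_neg _ (fun hq => hp ((hpq a b hab).2 hq))]

theorem msetOf_filter_congr {S : Finset α} {T : Finset α'} {f : α → β} {g : α' → β}
    {p : α → Prop} {q : α' → Prop} [DecidablePred p] [DecidablePred q]
    (h : msetOf S f = msetOf T g) (hpq : ∀ s t, f s = g t → (p s ↔ q t)) :
    msetOf (S.filter p) f = msetOf (T.filter q) g :=
  msetOf_eq_of_rel (by
    rw [Finset.filter_val, Finset.filter_val]
    exact rel_filter (rel_of_msetOf_eq h) hpq)

theorem exists_of_msetOf_eq {S : Finset α} {T : Finset α'} {f : α → β} {g : α' → β}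
    (h : msetOf S f = msetOf T g) {s : α} (hs : s ∈ S) : ∃ t ∈ T, f s = g t := by
  have : f s ∈ msetOf T g := h ▸ Multiset.mem_map_of_mem f hs
  obtain ⟨t, ht, he⟩ := Multiset.mem_map.1 this
  exact ⟨t, ht, he.symm⟩

theorem sum_eq_of_msetOf_eq {S : Finset α} {T : Finset α'} {f : α → ℕ} {g : α' → ℕ}
    (h : msetOf S f = msetOf T g) : ∑ s ∈ S, f s = ∑ t ∈ T, g t :=
  congrArg Multiset.sum h

end Multisets

/-! ### Neighbourhoods and walk counts -/

namespace FinConnGraph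

@[simp] theorem mem_verts (G : FinConnGraph) (v : G.V) : v ∈ G.verts := Finset.mem_univ v

@[simp] theorem mem_nbrs (G : FinConnGraph) {v w : G.V} : w ∈ G.nbrs v ↔ G.graph.Adj v w := by
  classical simp [nbrs]

@[simp] theorem mem_nbrs1 (G : FinConnGraph) {v w : G.V} :
    w ∈ G.nbrs1 v ↔ w = v ∨ G.graph.Adj v w := by
  classical simp [nbrs1]

/-- The sum of `f` over the endpoints of the walks of length `k` from `v`. -/
noncomputable def walkSum (G : FinConnGraph) (f : G.V → ℕ) : ℕ → G.V → ℕ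
  | 0, v => f v
  | k + 1, v => ∑ w ∈ G.nbrs v, walkSum G f k w

theorem sum_nbrs_comm (G : FinConnGraph) (f g : G.V → ℕ) :
    ∑ v, f v * ∑ w ∈ G.nbrs v, g w = ∑ v, (∑ w ∈ G.nbrs v, f w) * g v := by
  classical
  simp only [Finset.mul_sum, Finset.sum_mul, nbrs, Finset.sum_filter]
  rw [Finset.sum_comm]
  refine Finset.sum_congr rfl fun v _ => Finset.sum_congr rfl fun w _ => ?_
  simp only [G.graph.adj_comm w v, mul_ite, ite_mul, mul_zero, zero_mul]

/-- The adjacency matrix is symmetric, hence so are its powers. -/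
theorem sum_walkSum_comm (G : FinConnGraph) (f g : G.V → ℕ) (k : ℕ) :
    ∑ v, f v * G.walkSum g k v = ∑ v, G.walkSum f k v * g v := by
  induction k generalizing g with
  | zero => rfl
  | succ k ih =>
    -- The definition splits off the first step of a walk; the induction needs the last step split
    -- off instead.
    have h : ∀ v, G.walkSum g (k + 1) v = G.walkSum (fun v => ∑ w ∈ G.nbrs v, g w) k v := by
      clear ih
      induction k with
      | zero => exact fun _ => rfl
      | succ k ih => exact fun v => Finset.sum_congr rfl fun w _ => ih w
    simp only [h, ih, sum_nbrs_comm]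
    rfl

theorem exists_walkSum_pos (G : FinConnGraph) (f : G.V → ℕ) {u : G.V} (hu : 0 < f u) (v : G.V) :
    ∃ k, 0 < G.walkSum f k v := by
  obtain ⟨p⟩ := G.connected.preconnected v u
  induction p with
  | nil => exact ⟨0, hu⟩
  | @cons a b _ hab _ ih =>
    obtain ⟨k, hk⟩ := ih hu
    exact ⟨k + 1, hk.trans_le
      (Finset.single_le_sum (f := fun w => G.walkSum f k w) (fun _ _ => Nat.zero_le _)
        (G.mem_nbrs.2 hab))⟩

end FinConnGraph

/-! ### Equitable colourings of connected graphs -/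

section Equitable

variable {C : Type} {G H : FinConnGraph}

/-- Vertices of the same colour see the same multiset of colours among their neighbours. -/
def Equitable (α : G.V → C) (β : H.V → C) : Prop :=
  ∀ v y, α v = β y → msetOf (G.nbrs v) α = msetOf (H.nbrs y) β

theorem Equitable.symm {α : G.V → C} {β : H.V → C} (h : Equitable α β) : Equitable β α :=
  fun y v e => (h v y e.symm).symm

/-- By connectedness there is a walk from `v` to `w`, and equitability lifts it edge by edge to a
walk from `y` with the same colours. -/
theorem Equitable.exists_eq {α : G.V → C} {β : H.V → C} (h : Equitable α β) {v : G.V} {y : H.V}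
    (e : α v = β y) (w : G.V) : ∃ z, α w = β z := by
  obtain ⟨p⟩ := G.connected.preconnected v w
  induction p generalizing y with
  | nil => exact ⟨y, e⟩
  | cons hab _ ih =>
    obtain ⟨z, _, hz⟩ := exists_of_msetOf_eq (h _ _ e) (G.mem_nbrs.2 hab)
    exact ih hz

theorem Equitable.walkSum_eq {α : G.V → C} {β : H.V → C} (h : Equitable α β) {f : G.V → ℕ}
    {g : H.V → ℕ} (hfg : ∀ v y, α v = β y → f v = g y) (k : ℕ) :
    ∀ v y, α v = β y → G.walkSum f k v = H.walkSum g k y := by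
  induction k with
  | zero => exact hfg
  | succ k ih =>
    exact fun v y e => sum_eq_of_msetOf_eq (msetOf_congr (h v y e) fun s _ t _ => ih s t)

/-- In connected graphs, an equitable colouring that marks a root has the same histogram. -/
theorem Equitable.msetOf_verts {α : G.V → C} {β : H.V → C} (h : Equitable α β) {u : G.V} {x : H.V}
    (hroot : ∀ v y, α v = β y → (v = u ↔ y = x)) {v₀ : G.V} {y₀ : H.V} (h₀ : α v₀ = β y₀) :
    msetOf G.verts α = msetOf H.verts β := by
  classical
  have hux : α u = β x := by
    obtain ⟨y, hy⟩ := h.exists_eq h₀ u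
    rwa [(hroot u y hy).1 rfl] at hy
  refine Multiset.ext.2 fun c => ?_
  -- The double count: walks of length `k` from `r` into the class of `c` are reversed, and each of
  -- the vertices of the class starts exactly `m` walks back to `r`.
  have key : ∀ (K : FinConnGraph) (κ : K.V → C) (r : K.V) (k m : ℕ),
      (∀ v, κ v = c → K.walkSum (fun v => if v = r then 1 else 0) k v = m) →
      K.walkSum (fun v => if κ v = c then 1 else 0) k r = m * (msetOf K.verts κ).count c := by
    intro K κ r k m hm
    have h1 := K.sum_walkSum_comm (fun v => if v = r then 1 else 0)
      (fun v => if κ v = c then 1 else 0) k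
    simp only [ite_mul, one_mul, zero_mul, mul_ite, mul_one, mul_zero, Finset.sum_ite_eq',
      Finset.mem_univ, if_true] at h1
    rw [h1, ← Finset.sum_filter, Finset.sum_congr rfl (fun v hv => hm v (Finset.mem_filter.1 hv).2),
      Finset.sum_const, smul_eq_mul, mul_comm, msetOf, Multiset.count_map]
    congr 2
    simp only [eq_comm]
    rfl
  by_cases hc : ∃ w, α w = c
  · obtain ⟨w, rfl⟩ := hc
    obtain ⟨z, hz⟩ := h.exists_eq h₀ w
    -- This `k` makes the factor `m` of the double count positive, so that it can be cancelled at
    -- the end.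
    obtain ⟨k, hk⟩ := G.exists_walkSum_pos (fun v => if v = u then 1 else 0) (u := u) (by simp) w
    have hwalk := h.walkSum_eq (f := fun v => if v = u then 1 else 0)
      (g := fun y => if y = x then 1 else 0) (fun v y e => by simp only [hroot v y e]) k
    have hG := key G α u k _ fun v hv => (hwalk v z (hv.trans hz)).trans (hwalk w z hz).symm
    have hH := key H β x k _ fun y hy => (hwalk w y hy.symm).symm
    have e := h.walkSum_eq (f := fun v => if α v = α w then 1 else 0)
      (g := fun y => if β y = α w then 1 else 0) (fun v y e => by simp only [e]) k u x hux
    exact Nat.eq_of_mul_eq_mul_left hk (hG.symm.trans (e.trans hH))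
  · rw [Multiset.count_eq_zero_of_notMem, Multiset.count_eq_zero_of_notMem]
    · intro hm
      obtain ⟨y, _, rfl⟩ := Multiset.mem_map.1 hm
      obtain ⟨v, hv⟩ := h.symm.exists_eq h₀.symm y
      exact hc ⟨v, hv.symm⟩
    · intro hm
      obtain ⟨v, _, hv⟩ := Multiset.mem_map.1 hm
      exact hc ⟨v, hv⟩

end Equitable

/-! ### Preserved colourings and stable colours -/

section Stable

variable {G H : FinConnGraph}

theorem Agg.eval_congr {χ χ' : G.V → G.V → ℕ} {ψ ψ' : H.V → H.V → ℕ}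
    (hc : ∀ u v x y, χ u v = ψ x y → χ' u v = ψ' x y) {u v : G.V} {x y : H.V} (a : Agg)
    (h : a.eval G χ u v = a.eval H ψ x y) : a.eval G χ' u v = a.eval H ψ' x y := by
  cases a with
  | Gu | Gv | Lu | Lv => exact msetOf_congr h fun _ _ _ _ => hc _ _ _ _
  | Puv | Pvu | Puu | Pvv =>
    exact Multiset.singleton_inj.2 (hc _ _ _ _ (Multiset.singleton_inj.1 h))

/-- A colouring of the pairs of `G` and of `H` that the refinement step of an SWL test preserves. -/
def SwlStable (A : List Agg) (G H : FinConnGraph) (χ : G.V → G.V → ℕ) (ψ : H.V → H.V → ℕ) : Prop :=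
  ∀ u v x y, χ u v = ψ x y → nodeMark G u v = nodeMark H x y ∧
    ∀ a ∈ A, a.eval G χ u v = a.eval H ψ x y

/-- Stable colours form the coarsest preserved colouring: by induction on `t`, a preserved one
refines iteration `t`. -/
theorem SwlStable.stableColor_eq {A : List Agg} {χ : G.V → G.V → ℕ} {ψ : H.V → H.V → ℕ}
    (h : SwlStable A G H χ ψ) {u v : G.V} {x y : H.V} (e : χ u v = ψ x y) :
    stableColor (swlColor A G) u v = stableColor (swlColor A H) x y := by
  have key : ∀ t u v x y, χ u v = ψ x y → swlColor A G t u v = swlColor A H t x y := by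
    intro t
    induction t with
    | zero => exact fun u v x y e => (h u v x y e).1
    | succ t ih =>
      intro u v x y e
      refine congrArg hash (List.map_congr_left fun a ha => ?_)
      rcases List.mem_cons.1 ha with rfl | ha
      · exact Multiset.singleton_inj.2 (ih u v x y e)
      · exact a.eval_congr ih ((h u v x y e).2 a ha)
  exact funext fun t => key t u v x y e

theorem swlColor_zero_eq {A : List Agg} {t : ℕ} {u v : G.V} {x y : H.V}
    (h : swlColor A G t u v = swlColor A H t x y) : nodeMark G u v = nodeMark H x y := by
  induction t with
  | zero => exact h
  | succ t ih => exact ih (swlColor_refines A G H t u v x y h)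

theorem swlColor_agg_eq {A : List Agg} {t : ℕ} {u v : G.V} {x y : H.V}
    (h : swlColor A G (t + 1) u v = swlColor A H (t + 1) x y) {a : Agg} (ha : a ∈ A) :
    a.eval G (swlColor A G t) u v = a.eval H (swlColor A H t) x y :=
  List.map_inj_left.1 (hash_injective h) a (List.mem_cons_of_mem _ ha)

/-- Take an iteration `T` from which on equality of colours means equality of stable colours.
Equality at `T` then forces equality at `T + 1`, whose hash contains the aggregations of iteration
`T`. This also replaces colour sequences by plain numbers. -/
theorem exists_swlStable (A : List Agg) (G H : FinConnGraph) :
    ∃ χ ψ, SwlStable A G H χ ψ ∧ ∀ u v x y,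
      stableColor (swlColor A G) u v = stableColor (swlColor A H) x y → χ u v = ψ x y := by
  obtain ⟨T, hT⟩ := stableColor_eq_iff (swlColor A G) (swlColor A H) (swlColor_refines A G H)
  refine ⟨swlColor A G T, swlColor A H T, fun u v x y e => ⟨swlColor_zero_eq e, fun a ha => ?_⟩,
    fun u v x y => (hT T le_rfl u v x y).1⟩
  exact swlColor_agg_eq ((hT (T + 1) (Nat.le_succ T) u v x y).1 ((hT T le_rfl u v x y).2 e)) ha

/-- A colouring of the pairs of `G` and of `H` that the refinement step of a folklore-type test
preserves. -/
def FwlStable (S : Range) (G H : FinConnGraph) (χ : G.V → G.V → ℕ) (ψ : H.V → H.V → ℕ) : Prop :=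
  ∀ u v x y, χ u v = ψ x y → isoType G u v = isoType H x y ∧
    walk G u v (S G u v) χ = walk H x y (S H x y) ψ

theorem FwlStable.stableColor_eq {S : Range} {χ : G.V → G.V → ℕ} {ψ : H.V → H.V → ℕ}
    (h : FwlStable S G H χ ψ) {u v : G.V} {x y : H.V} (e : χ u v = ψ x y) :
    stableColor (fwlColor S G) u v = stableColor (fwlColor S H) x y := by
  have key : ∀ t u v x y, χ u v = ψ x y → fwlColor S G t u v = fwlColor S H t x y := by
    intro t
    induction t with
    | zero => exact fun u v x y e => (h u v x y e).1
    | succ t ih =>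
      intro u v x y e
      have hw : walk G u v (S G u v) (fwlColor S G t) = walk H x y (S H x y) (fwlColor S H t) :=
        msetOf_congr (h u v x y e).2 fun s _ z _ hs =>
          Prod.ext (ih _ _ _ _ (congrArg Prod.fst hs)) (ih _ _ _ _ (congrArg Prod.snd hs))
      exact congrArg hash (Prod.ext (ih u v x y e) hw)
  exact funext fun t => key t u v x y e

theorem fwlColor_zero_eq {S : Range} {t : ℕ} {u v : G.V} {x y : H.V}
    (h : fwlColor S G t u v = fwlColor S H t x y) : isoType G u v = isoType H x y := by
  induction t with
  | zero => exact h
  | succ t ih => exact ih (fwlColor_refines S G H t u v x y h)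

theorem fwlColor_walk_eq {S : Range} {t : ℕ} {u v : G.V} {x y : H.V}
    (h : fwlColor S G (t + 1) u v = fwlColor S H (t + 1) x y) :
    walk G u v (S G u v) (fwlColor S G t) = walk H x y (S H x y) (fwlColor S H t) :=
  congrArg Prod.snd (hash_injective h)

theorem exists_fwlStable (S : Range) (G H : FinConnGraph) :
    ∃ χ ψ, FwlStable S G H χ ψ ∧ ∀ u v x y,
      stableColor (fwlColor S G) u v = stableColor (fwlColor S H) x y → χ u v = ψ x y := by
  obtain ⟨T, hT⟩ := stableColor_eq_iff (fwlColor S G) (fwlColor S H) (fwlColor_refines S G H)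
  refine ⟨fwlColor S G T, fwlColor S H T, fun u v x y e => ⟨fwlColor_zero_eq e, ?_⟩,
    fun u v x y => (hT T le_rfl u v x y).1⟩
  exact fwlColor_walk_eq ((hT (T + 1) (Nat.le_succ T) u v x y).1 ((hT T le_rfl u v x y).2 e))

end Stable

/-! ### Outputs of tests through preserved colourings -/

section Pooling

variable {C : Type} {G H : FinConnGraph}

/-- The nested multiset of the values of `χ` under a pooling paradigm. -/
def pooled (P : Pool) (G : FinConnGraph) (χ : G.V → G.V → C) : Multiset (Multiset C) :=
  match P with
  | .VS => msetOf G.verts fun u => msetOf G.verts fun v => χ u v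
  | .SV => msetOf G.verts fun v => msetOf G.verts fun u => χ u v

/-- The multiset of the values of `χ` on all pairs. -/
def pairMset (G : FinConnGraph) (χ : G.V → G.V → C) : Multiset C :=
  msetOf (G.verts ×ˢ G.verts) fun p => χ p.1 p.2

theorem pooled_congr {C' : Type} {χ : G.V → G.V → C} {ψ : H.V → H.V → C} {χ' : G.V → G.V → C'}
    {ψ' : H.V → H.V → C'} (hc : ∀ u v x y, χ u v = ψ x y → χ' u v = ψ' x y) {P : Pool}
    (h : pooled P G χ = pooled P H ψ) : pooled P G χ' = pooled P H ψ' := by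
  cases P <;>
    exact msetOf_congr h fun _ _ _ _ h' => msetOf_congr h' fun _ _ _ _ => hc _ _ _ _

theorem pairMset_congr {C' : Type} {χ : G.V → G.V → C} {ψ : H.V → H.V → C} {χ' : G.V → G.V → C'}
    {ψ' : H.V → H.V → C'} (hc : ∀ u v x y, χ u v = ψ x y → χ' u v = ψ' x y)
    (h : pairMset G χ = pairMset H ψ) : pairMset G χ' = pairMset H ψ' :=
  msetOf_congr h fun _ _ _ _ => hc _ _ _ _

theorem swl_eq_pooled (A : List Agg) (P : Pool) (G : FinConnGraph) :
    swl A P G = pooled P G (stableColor (swlColor A G)) := by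
  cases P <;> rfl

theorem swl_eq_of_swlStable {A : List Agg} {P : Pool} {χ : G.V → G.V → ℕ} {ψ : H.V → H.V → ℕ}
    (h : SwlStable A G H χ ψ) (hP : pooled P G χ = pooled P H ψ) : swl A P G = swl A P H := by
  rw [swl_eq_pooled, swl_eq_pooled]
  exact pooled_congr (fun _ _ _ _ => h.stableColor_eq) hP

theorem exists_swlStable_of_swl_eq {A : List Agg} {P : Pool} (h : swl A P G = swl A P H) :
    ∃ χ ψ, SwlStable A G H χ ψ ∧ pooled P G χ = pooled P H ψ := by
  obtain ⟨χ, ψ, hs, hc⟩ := exists_swlStable A G H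
  rw [swl_eq_pooled, swl_eq_pooled] at h
  exact ⟨χ, ψ, hs, pooled_congr hc h⟩

theorem fwl_eq_of_fwlStable {S : Range} {χ : G.V → G.V → ℕ} {ψ : H.V → H.V → ℕ}
    (h : FwlStable S G H χ ψ) (hP : pairMset G χ = pairMset H ψ) : fwl S G = fwl S H :=
  pairMset_congr (fun _ _ _ _ => h.stableColor_eq) hP

theorem exists_fwlStable_of_fwl_eq {S : Range} (h : fwl S G = fwl S H) :
    ∃ χ ψ, FwlStable S G H χ ψ ∧ pairMset G χ = pairMset H ψ := by
  obtain ⟨χ, ψ, hs, hc⟩ := exists_fwlStable S G H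
  exact ⟨χ, ψ, hs, pairMset_congr hc h⟩

end Pooling

/-! ### The comparisons that hold -/

section Comparison

variable {G H : FinConnGraph} {χ : G.V → G.V → ℕ} {ψ : H.V → H.V → ℕ}

theorem nodeMark_eq_iff {u v : G.V} {x y : H.V} :
    nodeMark G u v = nodeMark H x y ↔ (u = v ↔ x = y) := by
  unfold nodeMark
  split_ifs <;> simp_all

theorem isoType_eq_iff {u v : G.V} {x y : H.V} :
    isoType G u v = isoType H x y ↔ ((u = v ↔ x = y) ∧ (G.graph.Adj u v ↔ H.graph.Adj x y)) := by
  have h1 : u = v → ¬ G.graph.Adj u v := fun h => h ▸ G.graph.loopless.irrefl u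
  have h2 : x = y → ¬ H.graph.Adj x y := fun h => h ▸ H.graph.loopless.irrefl x
  unfold isoType
  split_ifs <;> simp_all

/-- Each row, and each column, has exactly one marked entry, so matched rows or columns have
matching diagonal entries. -/
theorem msetOf_diag_of_pooled {P : Pool} (hm : ∀ u v x y, χ u v = ψ x y → (u = v ↔ x = y))
    (h : pooled P G χ = pooled P H ψ) :
    (msetOf G.verts fun v => χ v v) = msetOf H.verts fun y => ψ y y := by
  cases P
  · refine msetOf_congr h fun v _ y _ e => ?_
    obtain ⟨x, _, hx⟩ := exists_of_msetOf_eq e (G.mem_verts v)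
    rwa [← (hm _ _ _ _ hx).1 rfl] at hx
  · refine msetOf_congr h fun v _ y _ e => ?_
    obtain ⟨x, _, hx⟩ := exists_of_msetOf_eq e (G.mem_verts v)
    rwa [(hm _ _ _ _ hx).1 rfl] at hx

theorem msetOf_diag_of_pairMset (hm : ∀ u v x y, χ u v = ψ x y → (u = v ↔ x = y))
    (h : pairMset G χ = pairMset H ψ) :
    (msetOf G.verts fun v => χ v v) = msetOf H.verts fun y => ψ y y := by
  classical
  have h' := msetOf_filter_congr (p := fun p : G.V × G.V => p.1 = p.2)
    (q := fun p : H.V × H.V => p.1 = p.2) h fun _ _ => hm _ _ _ _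
  have key : ∀ (K : FinConnGraph) (κ : K.V → K.V → ℕ),
      msetOf ((K.verts ×ˢ K.verts).filter fun p => p.1 = p.2) (fun p => κ p.1 p.2)
        = msetOf K.verts fun v => κ v v := by
    intro K κ
    have : (K.verts ×ˢ K.verts).filter (fun p => p.1 = p.2)
        = K.verts.map ⟨fun v => (v, v), fun _ _ e => congrArg Prod.fst e⟩ := by
      ext ⟨a, b⟩
      simp only [Finset.mem_filter, Finset.mem_product, FinConnGraph.mem_verts, true_and, Finset.mem_map]
      exact ⟨fun h => ⟨a, Prod.ext rfl h⟩, fun ⟨c, hc⟩ => by cases hc; rfl⟩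
    rw [this, msetOf, Finset.map_val, Multiset.map_map]
    rfl
  rwa [key, key] at h'

theorem SwlStable.mark {A : List Agg} (h : SwlStable A G H χ ψ) {u v : G.V} {x y : H.V}
    (e : χ u v = ψ x y) : u = v ↔ x = y :=
  nodeMark_eq_iff.1 (h u v x y e).1

theorem SwlStable.mono {A B : List Agg} (h : SwlStable A G H χ ψ) (hBA : B ⊆ A) :
    SwlStable B G H χ ψ :=
  fun u v x y e => ⟨(h u v x y e).1, fun a ha => (h u v x y e).2 a (hBA ha)⟩

/-- `Lu` says precisely that each row `χ u` is equitable, and the node mark singles out its root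
`u`. So equal diagonal colours give equal rows. -/
theorem SwlStable.pooled_VS_of_diag {A : List Agg} (h : SwlStable A G H χ ψ) (hL : Agg.Lu ∈ A)
    (hd : (msetOf G.verts fun v => χ v v) = msetOf H.verts fun y => ψ y y) :
    pooled .VS G χ = pooled .VS H ψ := by
  refine msetOf_congr hd fun u _ x _ e => ?_
  have heq : Equitable (χ u) (ψ x) := fun v y e => (h u v x y e).2 _ hL
  refine heq.msetOf_verts (u := u) (x := x) (fun v y e => ?_) e
  rw [eq_comm, h.mark e, eq_comm]

theorem SwlStable.column_eq {A : List Agg} (h : SwlStable A G H χ ψ) (hL : Agg.Lv ∈ A)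
    {u v : G.V} {x y : H.V} (e : χ u v = ψ x y) :
    (msetOf G.verts fun w => χ w v) = msetOf H.verts fun z => ψ z y := by
  have heq : Equitable (fun w => χ w v) (fun z => ψ z y) := fun w z e => (h w v z y e).2 _ hL
  exact heq.msetOf_verts (u := v) (x := y) (fun _ _ => h.mark) e

theorem swl_VS_weakerEq_swl_SV {A : List Agg} (hL : Agg.Lu ∈ A) :
    WeakerEq (swl A .VS) (swl A .SV) := by
  intro G H h
  obtain ⟨χ, ψ, hs, hp⟩ := exists_swlStable_of_swl_eq h
  exact swl_eq_of_swlStable hs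
    (hs.pooled_VS_of_diag hL (msetOf_diag_of_pooled (fun _ _ _ _ => hs.mark) hp))

theorem swl_weakerEq_of_subset {A B : List Agg} (hBA : B ⊆ A) (P : Pool) :
    WeakerEq (swl B P) (swl A P) := by
  intro G H h
  obtain ⟨χ, ψ, hs, hp⟩ := exists_swlStable_of_swl_eq h
  exact swl_eq_of_swlStable (hs.mono hBA) hp

/-- The multiset of a column contains the diagonal colour as its only marked entry, which recovers
`Pvv`. Since `Gv` also makes the diagonal colour determine the column, the diagonal given by VS
pooling yields SV pooling. -/
theorem PSWL_SV_weakerEq_GSWL : WeakerEq (PSWL .SV) GSWL := by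
  intro G H h
  obtain ⟨χ, ψ, hs, hp⟩ := exists_swlStable_of_swl_eq h
  have hG : ∀ u v x y, χ u v = ψ x y →
      (msetOf G.verts fun w => χ w v) = msetOf H.verts fun z => ψ z y :=
    fun u v x y e => (hs u v x y e).2 .Gv (by simp)
  refine swl_eq_of_swlStable (χ := χ) (ψ := ψ) (fun u v x y e => ⟨(hs u v x y e).1, ?_⟩)
    (msetOf_congr (msetOf_diag_of_pooled (fun _ _ _ _ => hs.mark) hp)
      fun v _ y _ => hG v v y y)
  intro a ha
  rcases List.mem_pair.1 ha with rfl | rfl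
  · exact (hs u v x y e).2 .Lu (by simp)
  · obtain ⟨z, _, hz⟩ := exists_of_msetOf_eq (hG u v x y e) (G.mem_verts v)
    rw [(hs.mark hz).1 rfl] at hz
    exact Multiset.singleton_inj.2 hz

theorem GSWL_weakerEq_SSWL : WeakerEq GSWL SSWL := by
  intro G H h
  obtain ⟨χ, ψ, hs, hp⟩ := exists_swlStable_of_swl_eq h
  refine swl_eq_of_swlStable (fun u v x y e => ⟨(hs u v x y e).1, fun a ha => ?_⟩) hp
  rcases List.mem_pair.1 ha with rfl | rfl
  · exact (hs u v x y e).2 .Lu (by simp)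
  · exact hs.column_eq (by simp) e

theorem FwlStable.iso {S : Range} (h : FwlStable S G H χ ψ) {u v : G.V} {x y : H.V}
    (e : χ u v = ψ x y) :
    (u = v ↔ x = y) ∧ (G.graph.Adj u v ↔ H.graph.Adj x y) :=
  isoType_eq_iff.1 (h u v x y e).1

/-- The part of a walk multiset that is selected by the isomorphism types of its entries. -/
theorem FwlStable.walk_filter {S : Range} (h : FwlStable S G H χ ψ) {u v : G.V} {x y : H.V}
    (e : χ u v = ψ x y) {s : Finset G.V} {t : Finset H.V} (hs : s ⊆ S G u v) (ht : t ⊆ S H x y)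
    (hst : ∀ w z, χ u w = ψ x z → χ w v = ψ z y → (w ∈ s ↔ z ∈ t)) :
    walk G u v s χ = walk H x y t ψ := by
  classical
  have h' := msetOf_filter_congr (p := (· ∈ s)) (q := (· ∈ t)) (h u v x y e).2
    fun w z e => hst w z (congrArg Prod.fst e) (congrArg Prod.snd e)
  rwa [Finset.filter_mem_eq_inter, Finset.filter_mem_eq_inter, Finset.inter_eq_right.2 hs,
    Finset.inter_eq_right.2 ht] at h'

/-- Whether `w` is a neighbour of `v` is visible in the second entry of the colour pair at `w`, so
these pairs can be selected from the walk multiset. -/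
theorem FwlStable.Lu_eq {S : Range} (h : FwlStable S G H χ ψ) {u v : G.V} {x y : H.V}
    (e : χ u v = ψ x y) (hG : G.nbrs v ⊆ S G u v) (hH : H.nbrs y ⊆ S H x y) :
    Agg.Lu.eval G χ u v = Agg.Lu.eval H ψ x y :=
  msetOf_congr (h.walk_filter e hG hH fun w z _ e2 => by
    rw [G.mem_nbrs, H.mem_nbrs, G.graph.adj_comm, (h.iso e2).2, H.graph.adj_comm])
    fun _ _ _ _ => congrArg Prod.fst

theorem FwlStable.Lv_eq {S : Range} (h : FwlStable S G H χ ψ) {u v : G.V} {x y : H.V}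
    (e : χ u v = ψ x y) (hG : G.nbrs u ⊆ S G u v) (hH : H.nbrs x ⊆ S H x y) :
    Agg.Lv.eval G χ u v = Agg.Lv.eval H ψ x y :=
  msetOf_congr (h.walk_filter e hG hH fun w z e1 _ => by
    rw [G.mem_nbrs, H.mem_nbrs, (h.iso e1).2])
    fun _ _ _ _ => congrArg Prod.snd

/-- The pair collected at `w = v` has a second entry of the isomorphism type "equal", which forces
its partner to be `y`. -/
theorem FwlStable.Pvv_eq {S : Range} (h : FwlStable S G H χ ψ) {u v : G.V} {x y : H.V}
    (e : χ u v = ψ x y) (hG : v ∈ S G u v) :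
    Agg.Pvv.eval G χ u v = Agg.Pvv.eval H ψ x y := by
  obtain ⟨z, _, hz⟩ := exists_of_msetOf_eq (h u v x y e).2 hG
  have e2 : χ v v = ψ z y := congrArg Prod.snd hz
  rw [(h.iso e2).1.1 rfl] at e2
  exact Multiset.singleton_inj.2 e2

theorem nbrs_subset_nbrs1 (G : FinConnGraph) (v : G.V) : G.nbrs v ⊆ G.nbrs1 v := by
  classical exact Finset.subset_insert _ _

theorem PSWL_VS_weakerEq_LFWL2 : WeakerEq (PSWL .VS) LFWL2 := by
  intro G H h
  obtain ⟨χ, ψ, hs, hp⟩ := exists_fwlStable_of_fwl_eq h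
  have hst : SwlStable [.Lu, .Pvv] G H χ ψ := by
    refine fun u v x y e => ⟨nodeMark_eq_iff.2 (hs.iso e).1, fun a ha => ?_⟩
    rcases List.mem_pair.1 ha with rfl | rfl
    · exact hs.Lu_eq e (nbrs_subset_nbrs1 G v) (nbrs_subset_nbrs1 H y)
    · exact hs.Pvv_eq e (by simp)
  exact swl_eq_of_swlStable hst
    (hst.pooled_VS_of_diag (by simp) (msetOf_diag_of_pairMset (fun _ _ _ _ => hst.mark) hp))

theorem SSWL_weakerEq_SLFWL2 : WeakerEq SSWL SLFWL2 := by
  classical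
  intro G H h
  obtain ⟨χ, ψ, hs, hp⟩ := exists_fwlStable_of_fwl_eq h
  have hst : SwlStable [.Lu, .Lv] G H χ ψ := by
    refine fun u v x y e => ⟨nodeMark_eq_iff.2 (hs.iso e).1, fun a ha => ?_⟩
    rcases List.mem_pair.1 ha with rfl | rfl
    · refine hs.Lu_eq e ?_ ?_ <;> intro w hw <;> simp_all
    · refine hs.Lv_eq e ?_ ?_ <;> intro w hw <;> simp_all
  exact swl_eq_of_swlStable hst
    (hst.pooled_VS_of_diag (by simp) (msetOf_diag_of_pairMset (fun _ _ _ _ => hst.mark) hp))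

/-- A smaller range loses nothing to the larger one, provided that membership in it can be read off
the collected colour pair. -/
theorem FwlStable.restrict {S S' : Range} (h : FwlStable S G H χ ψ)
    (hsub : ∀ K u v, S' K u v ⊆ S K u v)
    (hmem : ∀ u v w x y z, χ u w = ψ x z → χ w v = ψ z y → (w ∈ S' G u v ↔ z ∈ S' H x y)) :
    FwlStable S' G H χ ψ :=
  fun u v x y e => ⟨(h u v x y e).1,
    h.walk_filter e (hsub G u v) (hsub H x y) fun w z => hmem u v w x y z⟩

theorem LFWL2_weakerEq_SLFWL2 : WeakerEq LFWL2 SLFWL2 := by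
  classical
  intro G H h
  obtain ⟨χ, ψ, hs, hp⟩ := exists_fwlStable_of_fwl_eq h
  refine fwl_eq_of_fwlStable (hs.restrict (fun K u v => ?_) fun u v w x y z _ e => ?_) hp
  · intro w hw
    simp_all
  · rw [G.mem_nbrs1, H.mem_nbrs1, G.graph.adj_comm, H.graph.adj_comm, (hs.iso e).1, (hs.iso e).2]

theorem SLFWL2_weakerEq_FWL2 : WeakerEq SLFWL2 FWL2 := by
  classical
  intro G H h
  obtain ⟨χ, ψ, hs, hp⟩ := exists_fwlStable_of_fwl_eq h
  refine fwl_eq_of_fwlStable (hs.restrict (fun K u v => ?_) fun u v w x y z e1 e2 => ?_) hp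
  · exact Finset.subset_univ _
  · rw [Finset.mem_union, Finset.mem_union, G.mem_nbrs1, H.mem_nbrs1, G.mem_nbrs1, H.mem_nbrs1,
      G.graph.adj_comm v, H.graph.adj_comm y, (hs.iso e2).1, (hs.iso e2).2, eq_comm (a := w), (hs.iso e1).1,
      (hs.iso e1).2, eq_comm (a := x)]

end Comparison

/-! ### Kernel-friendly arithmetic and codes of multisets -/

section Recursors

/-! Sums, counts and searches written with recursors and with functions that the kernel evaluates
fast. -/

noncomputable def sumRange (n : ℕ) (f : ℕ → ℕ) : ℕ :=
  Nat.rec 0 (fun i s => Nat.add s (f i)) n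

noncomputable def allRange (n : ℕ) (p : ℕ → Bool) : Bool :=
  Nat.rec true (fun i b => cond (p i) b false) n

noncomputable def filterRange (n : ℕ) (p : ℕ → Bool) : List ℕ :=
  Nat.rec [] (fun i l => cond (p i) (i :: l) l) n

noncomputable def sumList (l : List ℕ) (f : ℕ → ℕ) : ℕ :=
  List.rec 0 (fun a _ s => Nat.add (f a) s) l

noncomputable def allList {α : Type} (l : List α) (p : α → Bool) : Bool :=
  List.rec true (fun a _ b => cond (p a) b false) l

/-- The value of `q` at the first entry of `l` that satisfies `p`. -/
noncomputable def findList {α : Type} (l : List α) (p q : α → Bool) : Bool :=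
  List.rec false (fun a _ b => cond (p a) (q a) b) l

/-- The number of entries of `l` before the first one that satisfies `p`. -/
noncomputable def indexList {α : Type} (l : List α) (p : α → Bool) : ℕ :=
  List.rec 0 (fun a _ s => cond (p a) 0 (Nat.succ s)) l

/-- A code for the multiset of the values of `f` on `l`, which is positive if `l` is short. -/
noncomputable def listCode (l : List ℕ) (f : ℕ → ℕ) : ℕ :=
  cond (Nat.ble (sumList l fun _ => 1) 63) (Nat.succ (sumList l fun a => Nat.pow 64 (f a))) 0

/-- The code of a short multiset is `x`, and it is also `y`. -/
def sameCode (x y : ℕ) : Bool :=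
  cond (Nat.beq x y) (Nat.ble 1 x) false

theorem sumRange_eq (n : ℕ) (f : ℕ → ℕ) : sumRange n f = ((List.range n).map f).sum := by
  induction n with
  | zero => rfl
  | succ n ih =>
    rw [List.range_succ, List.map_append, List.sum_append, ← ih]
    simp [sumRange]

theorem allRange_iff {n : ℕ} {p : ℕ → Bool} : allRange n p ↔ ∀ i < n, p i := by
  induction n with
  | zero => simp [allRange]
  | succ n ih =>
    have : allRange (n + 1) p = (p n && allRange n p) := by
      simp only [allRange]
      cases p n <;> rfl
    rw [this, Bool.and_eq_true, ih, Nat.forall_lt_succ_right, and_comm]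

theorem filterRange_perm (n : ℕ) (p : ℕ → Bool) :
    (filterRange n p).Perm ((List.range n).filter p) := by
  induction n with
  | zero => rfl
  | succ n ih =>
    have : filterRange (n + 1) p = bif p n then n :: filterRange n p else filterRange n p := rfl
    rw [this, List.range_succ, List.filter_append]
    cases h : p n
    · simpa [h] using ih
    · simpa [h] using (ih.cons n).trans (List.perm_append_singleton n _).symm

theorem sumList_eq (l : List ℕ) (f : ℕ → ℕ) : sumList l f = (l.map f).sum := by
  induction l with
  | nil => rfl
  | cons a l ih => rw [List.map_cons, List.sum_cons, ← ih]; rfl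

theorem allList_iff {α : Type} {l : List α} {p : α → Bool} : allList l p ↔ ∀ a ∈ l, p a := by
  induction l with
  | nil => simp [allList]
  | cons a l ih =>
    have : allList (a :: l) p = (p a && allList l p) := by
      simp only [allList]
      cases p a <;> rfl
    rw [this, Bool.and_eq_true, ih, List.forall_mem_cons]

theorem findList_iff {α : Type} {l : List α} {p q : α → Bool} :
    findList l p q ↔ ∃ a, l.find? p = some a ∧ q a := by
  induction l with
  | nil => simp [findList]
  | cons a l ih =>
    have : findList (a :: l) p q = bif p a then q a else findList l p q := rfl
    rw [this, List.find?_cons]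
    cases h : p a
    · simpa [h] using ih
    · simp

/-- The number with the digits `f 0, …, f (n - 1)` in base `b`. -/
noncomputable def packRange (b n : ℕ) (f : ℕ → ℕ) : ℕ :=
  Nat.rec 0 (fun i s => Nat.add s (Nat.mul (Nat.pow b i) (f i))) n

theorem packRange_succ (b n : ℕ) (f : ℕ → ℕ) :
    packRange b (n + 1) f = packRange b n f + b ^ n * f n := rfl

theorem packRange_lt {b : ℕ} (n : ℕ) {f : ℕ → ℕ} (hf : ∀ i, f i < b) : packRange b n f < b ^ n := by
  induction n with
  | zero => exact Nat.one_pos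
  | succ n ih =>
    rw [packRange_succ, pow_succ]
    calc packRange b n f + b ^ n * f n < b ^ n + b ^ n * f n := by omega
      _ = b ^ n * (f n + 1) := by ring
      _ ≤ b ^ n * b := Nat.mul_le_mul_left _ (hf n)

theorem packRange_div_mod {b n : ℕ} {f : ℕ → ℕ} (hf : ∀ i, f i < b) {i : ℕ} (hi : i < n) :
    packRange b n f / b ^ i % b = f i := by
  have hb : 0 < b := (Nat.zero_le _).trans_lt (hf 0)
  induction n with
  | zero => omega
  | succ n ih =>
    rw [packRange_succ]
    rcases Nat.lt_succ_iff_lt_or_eq.1 hi with h | rfl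
    -- The new top digit contributes a multiple of `b ^ (i + 1)`, which does not affect digit `i`.
    · rw [← ih h, show b ^ n * f n = b ^ i * (b * (b ^ (n - i - 1) * f n)) by
        rw [← mul_assoc, ← mul_assoc, ← pow_succ, ← pow_add]
        congr 2
        omega, Nat.add_mul_div_left _ _ (pow_pos hb i), Nat.add_mul_mod_self_left]
    · rw [Nat.add_mul_div_left _ _ (pow_pos hb i), Nat.div_eq_of_lt (packRange_lt i hf), zero_add,
        Nat.mod_eq_of_lt (hf i)]

theorem packRange_count_cons {b n a : ℕ} (l : List ℕ) (ha : a < n) :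
    packRange b n (fun k => (a :: l).count k) = packRange b n (fun k => l.count k) + b ^ a := by
  have h : ∀ m, packRange b m (fun k => (a :: l).count k)
      = packRange b m (fun k => l.count k) + if a < m then b ^ a else 0 := by
    intro m
    induction m with
    | zero => rfl
    | succ m ih =>
      rw [packRange_succ, packRange_succ, ih, List.count_cons]
      rcases Nat.lt_trichotomy a m with h | rfl | h
      · simp [h, h.ne, Nat.lt_succ_of_lt h]
        ring
      · simp
        ring
      · simp [h.ne', h.not_gt, (Nat.succ_le_of_lt h).not_gt]
  rw [h, if_pos ha]

theorem sum_pow_eq_packRange {b n : ℕ} {l : List ℕ} (hl : ∀ a ∈ l, a < n) :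
    (l.map fun a => b ^ a).sum = packRange b n fun k => l.count k := by
  induction l with
  | nil =>
    clear hl
    induction n with
    | zero => rfl
    | succ n ih => simpa [packRange_succ] using ih
  | cons a l ih =>
    rw [packRange_count_cons l (hl a (by simp)), ← ih fun a h => hl a (by simp [h]), List.map_cons,
      List.sum_cons, add_comm]

/-- With fewer than `b` entries no carry occurs, so the base `b` digits of the sum are the
multiplicities. -/
theorem perm_of_sum_pow_eq {b : ℕ} {l m : List ℕ} (hl : l.length < b) (hm : m.length < b)
    (h : (l.map fun a => b ^ a).sum = (m.map fun a => b ^ a).sum) : l.Perm m := by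
  refine List.perm_iff_count.2 fun k => ?_
  have hle : ∀ s : List ℕ, ∀ a ∈ s, a ≤ s.sum := fun s a => List.le_sum_of_mem
  -- A number of digits that exceeds all entries of both lists and the position `k` of interest.
  have hl' : ∀ a ∈ l, a < l.sum + m.sum + k + 1 := fun a ha => by have := hle l a ha; omega
  have hm' : ∀ a ∈ m, a < l.sum + m.sum + k + 1 := fun a ha => by have := hle m a ha; omega
  rw [sum_pow_eq_packRange hl', sum_pow_eq_packRange hm'] at h
  rw [← packRange_div_mod (f := fun k => l.count k)
    (fun i => List.count_le_length.trans_lt hl) (show k < l.sum + m.sum + k + 1 by omega), h]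
  exact packRange_div_mod (f := fun k => m.count k)
    (fun i => List.count_le_length.trans_lt hm) (by omega)

/-- The code `0` stands for a list that is too long. `sameCode` rejects it, so both lists have fewer
than 64 entries and the codes are faithful. -/
theorem perm_of_sameCode {l m : List ℕ} {f g : ℕ → ℕ}
    (h : sameCode (listCode l f) (listCode m g)) : (l.map f).Perm (m.map g) := by
  rw [sameCode, Bool.cond_false_right, Bool.and_eq_true, Nat.beq_eq] at h
  have hlen : ∀ (l : List ℕ) (f : ℕ → ℕ), 1 ≤ listCode l f → (l.map f).length < 64 ∧
      listCode l f = ((l.map f).map fun a => 64 ^ a).sum + 1 := by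
    intro l f hl
    unfold listCode at hl ⊢
    cases hb : Nat.ble (sumList l fun _ => 1) 63
    · rw [hb] at hl
      cases hl
    · have := Nat.le_of_ble_eq_true hb
      rw [sumList_eq] at this
      refine ⟨by simp at this ⊢; omega, ?_⟩
      rw [cond_true, sumList_eq, List.map_map]
      rfl
  have h0 : 1 ≤ listCode l f := Nat.le_of_ble_eq_true h.2
  obtain ⟨h1, h2⟩ := hlen l f h0
  obtain ⟨h3, h4⟩ := hlen m g (h.1 ▸ h0)
  refine perm_of_sum_pow_eq h1 h3 ?_
  have := h.1
  omega

end Recursors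

/-! ### Graphs encoded by the bits of a number -/

section BitGraph

/-- Adjacency in the graph on `0, …, n - 1` whose edges are the nonzero bits of `A`, read as a
matrix with rows of length `n`. -/
def bitAdj (n A i j : ℕ) : Bool :=
  cond (Nat.beq i j) false (cond (Nat.testBit A (Nat.add (Nat.mul n i) j)) true
    (Nat.testBit A (Nat.add (Nat.mul n j) i)))

theorem bitAdj_comm (n A i j : ℕ) : bitAdj n A i j = bitAdj n A j i := by
  have h : Nat.beq i j = Nat.beq j i := Bool.eq_iff_iff.2 (by
    rw [Nat.beq_eq, Nat.beq_eq]
    exact eq_comm)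
  rw [bitAdj, bitAdj, h]
  cases Nat.testBit A (Nat.add (Nat.mul n i) j) <;>
    cases Nat.testBit A (Nat.add (Nat.mul n j) i) <;> rfl

def bitSimpleGraph (n A : ℕ) : SimpleGraph (Fin n) where
  Adj i j := bitAdj n A i j
  symm := ⟨fun i j h => by rwa [bitAdj_comm]⟩
  loopless := ⟨fun i h => by simp [bitAdj] at h⟩

/-- Every vertex but `0` has a smaller neighbour. -/
def bitConnected (n A : ℕ) : Bool :=
  0 < n && (List.range n).all fun i => i == 0 || (List.range i).any (bitAdj n A i)

theorem bitSimpleGraph_connected {n A : ℕ} (h : bitConnected n A) :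
    (bitSimpleGraph n A).Connected := by
  simp only [bitConnected, Bool.and_eq_true, decide_eq_true_eq, List.all_eq_true, List.mem_range,
    Bool.or_eq_true, beq_iff_eq, List.any_eq_true] at h
  obtain ⟨hn, h⟩ := h
  have key : ∀ i (hi : i < n), (bitSimpleGraph n A).Reachable ⟨i, hi⟩ ⟨0, hn⟩ := by
    intro i
    induction i using Nat.strong_induction_on with
    | _ i ih =>
      intro hi
      rcases h i hi with rfl | ⟨j, hj, ha⟩
      · exact .refl _
      · have hij : (bitSimpleGraph n A).Adj ⟨i, hi⟩ ⟨j, hj.trans hi⟩ := ha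
        exact hij.reachable.trans (ih j hj (hj.trans hi))
  have : Nonempty (Fin n) := ⟨⟨0, hn⟩⟩
  exact ⟨fun u v => (key u u.2).trans (key v v.2).symm⟩

def bitGraph (n A : ℕ) (h : bitConnected n A) : FinConnGraph :=
  ⟨Fin n, bitSimpleGraph n A, bitSimpleGraph_connected h⟩

noncomputable def bitNbrs (n A v : ℕ) : List ℕ :=
  filterRange n (bitAdj n A v)

variable {n A B : ℕ} {h : bitConnected n A}

/-- The number of a vertex of a bit graph. -/
def idx (v : (bitGraph n A h).V) : ℕ := Fin.val (n := n) v

theorem idx_lt (v : (bitGraph n A h).V) : idx v < n := Fin.isLt (n := n) v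

theorem idx_inj {u v : (bitGraph n A h).V} : idx u = idx v ↔ u = v := (Fin.ext_iff (n := n)).symm

theorem map_idx_verts : (bitGraph n A h).verts.val.map idx = (List.range n : Multiset ℕ) := by
  rw [← List.map_coe_finRange_eq_range, ← List.ofFn_eq_map]
  exact Fin.univ_val_map (n := n) Fin.val

theorem adj_bitGraph {u v : (bitGraph n A h).V} :
    (bitGraph n A h).graph.Adj u v ↔ bitAdj n A (idx u) (idx v) := Iff.rfl

/-- The colouring of the pairs of vertices of a bit graph that is given by a function of their
numbers. -/
def bitColoring (c : ℕ → ℕ → ℕ) (u v : (bitGraph n A h).V) : ℕ :=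
  c (idx u) (idx v)

/-- The list `l` enumerates the vertices in `S`. -/
def Enumerates (l : List ℕ) (S : Finset (bitGraph n A h).V) : Prop :=
  S.val.map idx = (l : Multiset ℕ)

theorem Enumerates.msetOf_eq {β : Type} {l : List ℕ} {S : Finset (bitGraph n A h).V}
    (hl : Enumerates l S) (f : ℕ → β) : (msetOf S fun w => f (idx w)) = (l.map f : List β) := by
  rw [← Multiset.map_coe, ← hl, Multiset.map_map]
  rfl

theorem enumerates_filter (p : ℕ → Bool) (S : Finset (bitGraph n A h).V)
    (hS : ∀ w, w ∈ S ↔ p (idx w)) : Enumerates (filterRange n p) S := by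
  have hS' : S = (bitGraph n A h).verts.filter fun w => p (idx w) := by
    ext w
    rw [Finset.mem_filter, hS w]
    simp
  have h1 : (filterRange n p : Multiset ℕ)
      = (List.range n : Multiset ℕ).filter fun i => p i = true := by
    rw [Multiset.filter_coe, Multiset.coe_eq_coe.2 (filterRange_perm n p)]
    congr 2
    funext i
    simp
  rw [Enumerates, hS', Finset.filter_val, h1, ← map_idx_verts (h := h), Multiset.filter_map]
  rfl

theorem enumerates_verts : Enumerates (List.range n) (bitGraph n A h).verts :=
  map_idx_verts

theorem enumerates_verts_filter :
    Enumerates (filterRange n fun _ => true) (bitGraph n A h).verts :=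
  enumerates_filter _ _ fun w => iff_of_true (FinConnGraph.mem_verts _ w) rfl

theorem enumerates_nbrs (v : (bitGraph n A h).V) :
    Enumerates (bitNbrs n A (idx v)) ((bitGraph n A h).nbrs v) :=
  enumerates_filter _ _ fun _ => (bitGraph n A h).mem_nbrs

theorem mem_nbrs1_bitGraph (v w : (bitGraph n A h).V) :
    w ∈ (bitGraph n A h).nbrs1 v ↔ cond (Nat.beq (idx w) (idx v)) true
      (bitAdj n A (idx v) (idx w)) := by
  rw [Bool.cond_true_left, FinConnGraph.mem_nbrs1, Bool.or_eq_true, Nat.beq_eq, idx_inj,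
    adj_bitGraph]

open Classical in
theorem nodeMark_bitGraph (u v : (bitGraph n A h).V) :
    nodeMark (bitGraph n A h) u v = cond (Nat.beq (idx u) (idx v)) 1 0 := by
  rw [Bool.cond_eq_ite]
  exact if_congr (by rw [Nat.beq_eq, idx_inj]) rfl rfl

/-- The isomorphism type of a pair of vertices of a bit graph. -/
def bitIsoType (n A u v : ℕ) : ℕ :=
  cond (Nat.beq u v) 0 (cond (bitAdj n A u v) 1 2)

open Classical in
theorem isoType_bitGraph (u v : (bitGraph n A h).V) :
    isoType (bitGraph n A h) u v = bitIsoType n A (idx u) (idx v) := by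
  rw [bitIsoType, Bool.cond_eq_ite, Bool.cond_eq_ite]
  exact if_congr (by rw [Nat.beq_eq, idx_inj]) rfl (if_congr adj_bitGraph rfl rfl)

/-- The indices over which an aggregation operation runs. -/
noncomputable def aggSupport (n A u v : ℕ) : Agg → List ℕ
  | .Puv | .Pvu | .Puu | .Pvv => [0]
  | .Gu | .Gv => filterRange n fun _ => true
  | .Lu => bitNbrs n A v
  | .Lv => bitNbrs n A u

/-- The value that an aggregation operation collects at the index `w`. -/
def aggValue (c : ℕ → ℕ → ℕ) (u v : ℕ) : Agg → ℕ → ℕ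
  | .Puv => fun _ => c u v
  | .Pvu => fun _ => c v u
  | .Puu => fun _ => c u u
  | .Pvv => fun _ => c v v
  | .Gu | .Lu => fun w => c u w
  | .Gv | .Lv => fun w => c w v

theorem eval_bitColoring (c : ℕ → ℕ → ℕ) (u v : (bitGraph n A h).V) (a : Agg) :
    a.eval (bitGraph n A h) (bitColoring c) u v =
      ((aggSupport n A (idx u) (idx v) a).map (aggValue c (idx u) (idx v) a) : List ℕ) := by
  cases a with
  | Puv | Pvu | Puu | Pvv => rfl
  | Gu => exact enumerates_verts_filter.msetOf_eq fun w => c (idx u) w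
  | Gv => exact enumerates_verts_filter.msetOf_eq fun w => c w (idx v)
  | Lu => exact (enumerates_nbrs v).msetOf_eq fun w => c (idx u) w
  | Lv => exact (enumerates_nbrs u).msetOf_eq fun w => c w (idx v)

/-- Apply `F` to the indices and values of an aggregation operation. -/
noncomputable def aggFold {β : Type} (F : List ℕ → (ℕ → ℕ) → β) (n A : ℕ) (c : ℕ → ℕ → ℕ) (u v : ℕ)
    (a : Agg) : β :=
  Agg.rec (F [0] fun _ => c u v) (F [0] fun _ => c v u) (F [0] fun _ => c u u)
    (F [0] fun _ => c v v) (F (filterRange n fun _ => true) fun w => c u w)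
    (F (filterRange n fun _ => true) fun w => c w v) (F (bitNbrs n A v) fun w => c u w)
    (F (bitNbrs n A u) fun w => c w v) a

theorem aggFold_eq {β : Type} (F : List ℕ → (ℕ → ℕ) → β) (n A : ℕ) (c : ℕ → ℕ → ℕ) (u v : ℕ)
    (a : Agg) : aggFold F n A c u v a = F (aggSupport n A u v a) (aggValue c u v a) := by
  cases a <;> rfl

/-- A code for the colour pair that a folklore-type test collects at `w`. -/
def walkValue (c : ℕ → ℕ → ℕ) (u v w : ℕ) : ℕ :=
  Nat.add (Nat.mul (c u w) 64) (c w v)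

/-- The range `S` of a folklore-type test is given on bit graphs by the lists `L`. -/
def EnumeratesRange (L : ℕ → ℕ → ℕ → ℕ → List ℕ) (S : Range) : Prop :=
  ∀ n A h (u v : (bitGraph n A h).V), Enumerates (L n A (idx u) (idx v)) (S (bitGraph n A h) u v)

theorem walk_map_eq {L : ℕ → ℕ → ℕ → ℕ → List ℕ} {S : Range} (hS : EnumeratesRange L S)
    (c : ℕ → ℕ → ℕ) (u v : (bitGraph n A h).V) :
    (walk (bitGraph n A h) u v (S _ u v) (bitColoring c)).map (fun p => p.1 * 64 + p.2)
      = ((L n A (idx u) (idx v)).map (walkValue c (idx u) (idx v)) : List ℕ) := by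
  rw [walk, msetOf, Multiset.map_map]
  exact (hS n A h u v).msetOf_eq (walkValue c (idx u) (idx v))

noncomputable def rangeLFWL2 (n A _u v : ℕ) : List ℕ :=
  filterRange n fun w => cond (Nat.beq w v) true (bitAdj n A v w)

noncomputable def rangeSLFWL2 (n A u v : ℕ) : List ℕ :=
  filterRange n fun w => cond (cond (Nat.beq w u) true (bitAdj n A u w)) true
    (cond (Nat.beq w v) true (bitAdj n A v w))

noncomputable def rangeFWL2 (n _A _u _v : ℕ) : List ℕ :=
  filterRange n fun _ => true

theorem enumeratesRange_LFWL2 : EnumeratesRange rangeLFWL2 fun G _ v => G.nbrs1 v :=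
  fun _ _ _ _ v => enumerates_filter _ _ fun w => mem_nbrs1_bitGraph v w

open Classical in
theorem enumeratesRange_SLFWL2 :
    EnumeratesRange rangeSLFWL2 fun G u v => G.nbrs1 u ∪ G.nbrs1 v :=
  fun _ _ h u v => enumerates_filter _ _ fun w => by
    rw [Finset.mem_union, mem_nbrs1_bitGraph, mem_nbrs1_bitGraph, ← Bool.or_eq_true,
      ← Bool.cond_true_left]

theorem enumeratesRange_FWL2 : EnumeratesRange rangeFWL2 fun G _ _ => G.verts :=
  fun _ _ _ _ _ => enumerates_verts_filter

end BitGraph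

/-! ### Colourings stored as single numbers -/

section Tabulation

/-- A prime modulus for colours, just below `2 ^ 20`. -/
def colorMod : ℕ := 1048573

/-- The values modulo `colorMod` of `f` on pairs of numbers below `n`, packed in a number. -/
noncomputable def tabulate (n : ℕ) (f : ℕ → ℕ → ℕ) : ℕ :=
  packRange (Nat.pow 1048576 n) n fun u => packRange 1048576 n fun v => Nat.mod (f u v) colorMod

/-- The digit `v` in base `2 ^ 20` of the digit `u` in base `(2 ^ 20) ^ n`. -/
def lookup (n s u v : ℕ) : ℕ :=
  Nat.mod (Nat.div (Nat.mod (Nat.div s (Nat.pow (Nat.pow 1048576 n) u)) (Nat.pow 1048576 n))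
    (Nat.pow 1048576 v)) 1048576

theorem lookup_tabulate {n : ℕ} (f : ℕ → ℕ → ℕ) {u v : ℕ} (hu : u < n) (hv : v < n) :
    lookup n (tabulate n f) u v = f u v % colorMod := by
  have hlt : ∀ u v, Nat.mod (f u v) colorMod < 1048576 := fun u v =>
    (Nat.mod_lt _ (by norm_num [colorMod])).trans (by norm_num [colorMod])
  change tabulate n f / (1048576 ^ n) ^ u % 1048576 ^ n / 1048576 ^ v % 1048576 = _
  have h1 := packRange_div_mod (b := 1048576 ^ n)
    (f := fun u => packRange 1048576 n fun v => Nat.mod (f u v) colorMod)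
    (fun u => packRange_lt n (hlt u)) hu
  have h2 : tabulate n f / (1048576 ^ n) ^ u % 1048576 ^ n = _ := h1
  rw [h2]
  exact packRange_div_mod (hlt u) hv

/-- The tables of the colourings obtained by iterating `step`. -/
noncomputable def iterTable (n : ℕ) (init : ℕ → ℕ → ℕ) (step : (ℕ → ℕ → ℕ) → ℕ → ℕ → ℕ) (t : ℕ) : ℕ :=
  (fun s => tabulate n (step (lookup n s)))^[t] (tabulate n init)

/-- A round reads the previous one from a table rather than through nested recursion over all
earlier rounds. -/
noncomputable def iterColor (n : ℕ) (init : ℕ → ℕ → ℕ) (step : (ℕ → ℕ → ℕ) → ℕ → ℕ → ℕ) (t : ℕ) :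
    ℕ → ℕ → ℕ :=
  lookup n (iterTable n init step t)

variable {n : ℕ} {init : ℕ → ℕ → ℕ} {step : (ℕ → ℕ → ℕ) → ℕ → ℕ → ℕ}

theorem iterColor_zero {u v : ℕ} (hu : u < n) (hv : v < n) :
    iterColor n init step 0 u v = init u v % colorMod :=
  lookup_tabulate init hu hv

theorem iterColor_succ (t : ℕ) {u v : ℕ} (hu : u < n) (hv : v < n) :
    iterColor n init step (t + 1) u v = step (iterColor n init step t) u v % colorMod := by
  rw [iterColor, iterTable, Function.iterate_succ_apply']
  exact lookup_tabulate _ hu hv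

end Tabulation

/-! ### Numerical hashes that prove outputs different -/

section HashColorings

/-- A nonlinear map, so that a sum of its values depends on more than the sum of the arguments.
Injectivity is never needed. -/
def hashNum (x : ℕ) : ℕ := Nat.mod (Nat.mul x x) 65537

/-- A numerical version of the refinement step of an SWL test. -/
noncomputable def swlStep (As : List Agg) (n A : ℕ) (c : ℕ → ℕ → ℕ) (u v : ℕ) : ℕ :=
  As.foldl (fun s a => Nat.add (Nat.mul s 5)
    (aggFold (fun l f => sumList l fun w => hashNum (f w)) n A c u v a)) (c u v)

/-- A numerical version of the SWL colouring after `t` iterations. -/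
noncomputable def swlHash (As : List Agg) (n A t : ℕ) : ℕ → ℕ → ℕ :=
  iterColor n (fun u v => cond (Nat.beq u v) 1 0) (swlStep As n A) t

/-- A numerical version of the refinement step of a folklore-type test. -/
noncomputable def fwlStep (L : ℕ → ℕ → ℕ → ℕ → List ℕ) (n A : ℕ) (c : ℕ → ℕ → ℕ) (u v : ℕ) : ℕ :=
  Nat.add (Nat.mul (c u v) 5)
    (sumList (L n A u v) fun w => hashNum (Nat.add (Nat.mul (c u w) 5) (c w v)))

/-- A numerical version of the folklore-type colouring after `t` iterations. -/
noncomputable def fwlHash (L : ℕ → ℕ → ℕ → ℕ → List ℕ) (n A t : ℕ) : ℕ → ℕ → ℕ :=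
  iterColor n (bitIsoType n A) (fwlStep L n A) t

variable {n A B : ℕ} {hA : bitConnected n A} {hB : bitConnected n B}

/-- The numerical step depends only on the old colour and on sums over the aggregated multisets, so
the hash is a function of the true colour, and different hashes prove different colours. -/
theorem swlHash_eq {As : List Agg} (t : ℕ) : ∀ u v x y,
    swlColor As (bitGraph n A hA) t u v = swlColor As (bitGraph n B hB) t x y →
    bitColoring (h := hA) (swlHash As n A t) u v
      = bitColoring (h := hB) (swlHash As n B t) x y := by
  induction t with
  | zero =>
    intro u v x y e
    change iterColor _ _ _ 0 (idx u) (idx v) = iterColor _ _ _ 0 (idx x) (idx y)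
    rw [iterColor_zero (idx_lt u) (idx_lt v), iterColor_zero (idx_lt x) (idx_lt y),
      ← nodeMark_bitGraph (h := hA), ← nodeMark_bitGraph (h := hB)]
    exact congrArg (· % colorMod) e
  | succ t ih =>
    intro u v x y e
    change iterColor _ _ _ (t + 1) (idx u) (idx v) = iterColor _ _ _ (t + 1) (idx x) (idx y)
    rw [iterColor_succ _ (idx_lt u) (idx_lt v), iterColor_succ _ (idx_lt x) (idx_lt y)]
    have e0 : swlHash As n A t (idx u) (idx v) = swlHash As n B t (idx x) (idx y) :=
      ih u v x y (swlColor_refines As (bitGraph n A hA) (bitGraph n B hB) t u v x y e)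
    have e1 : ∀ a ∈ As, (sumList (aggSupport n A (idx u) (idx v) a) fun w =>
          hashNum (aggValue (swlHash As n A t) (idx u) (idx v) a w))
        = sumList (aggSupport n B (idx x) (idx y) a) fun w =>
          hashNum (aggValue (swlHash As n B t) (idx x) (idx y) a w) := by
      intro a ha
      have h1 := a.eval_congr ih (swlColor_agg_eq e ha)
      rw [eval_bitColoring, eval_bitColoring, Multiset.coe_eq_coe] at h1
      have h2 := (h1.map hashNum).sum_eq
      rw [List.map_map, List.map_map] at h2
      rw [sumList_eq, sumList_eq]
      exact h2
    refine congrArg (· % colorMod) ?_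
    change swlStep As n A (swlHash As n A t) (idx u) (idx v)
      = swlStep As n B (swlHash As n B t) (idx x) (idx y)
    rw [swlStep, swlStep, e0]
    exact List.foldl_ext _ _ _ fun s a ha => by rw [aggFold_eq, aggFold_eq, e1 a ha]

theorem fwlHash_eq {L : ℕ → ℕ → ℕ → ℕ → List ℕ} {S : Range} (hS : EnumeratesRange L S) (t : ℕ) :
    ∀ u v x y,
    fwlColor S (bitGraph n A hA) t u v = fwlColor S (bitGraph n B hB) t x y →
    bitColoring (h := hA) (fwlHash L n A t) u v
      = bitColoring (h := hB) (fwlHash L n B t) x y := by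
  induction t with
  | zero =>
    intro u v x y e
    change iterColor _ _ _ 0 (idx u) (idx v) = iterColor _ _ _ 0 (idx x) (idx y)
    rw [iterColor_zero (idx_lt u) (idx_lt v), iterColor_zero (idx_lt x) (idx_lt y),
      ← isoType_bitGraph (h := hA), ← isoType_bitGraph (h := hB)]
    exact congrArg (· % colorMod) e
  | succ t ih =>
    intro u v x y e
    change iterColor _ _ _ (t + 1) (idx u) (idx v) = iterColor _ _ _ (t + 1) (idx x) (idx y)
    rw [iterColor_succ _ (idx_lt u) (idx_lt v), iterColor_succ _ (idx_lt x) (idx_lt y)]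
    have e0 : fwlHash L n A t (idx u) (idx v) = fwlHash L n B t (idx x) (idx y) :=
      ih u v x y (fwlColor_refines S (bitGraph n A hA) (bitGraph n B hB) t u v x y e)
    have e1 : walk (bitGraph n A hA) u v _ (bitColoring (fwlHash L n A t))
        = walk (bitGraph n B hB) x y _ (bitColoring (fwlHash L n B t)) :=
      msetOf_congr (fwlColor_walk_eq e) fun s _ z _ hs =>
        Prod.ext (ih _ _ _ _ (congrArg Prod.fst hs)) (ih _ _ _ _ (congrArg Prod.snd hs))
    have e2 : (sumList (L n A (idx u) (idx v)) fun w => hashNum (Nat.add (Nat.mul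
          (fwlHash L n A t (idx u) w) 5) (fwlHash L n A t w (idx v))))
        = sumList (L n B (idx x) (idx y)) fun w => hashNum (Nat.add (Nat.mul
          (fwlHash L n B t (idx x) w) 5) (fwlHash L n B t w (idx y))) := by
      have h1 := congrArg (fun m => (m.map fun p => hashNum (p.1 * 5 + p.2)).sum) e1
      simp only [walk, msetOf, Multiset.map_map] at h1
      rw [sumList_eq, sumList_eq]
      refine Eq.trans ?_ (h1.trans ?_)
      · exact (congrArg Multiset.sum ((hS n A hA u v).msetOf_eq fun w => hashNum (Nat.add (Nat.mul
          (fwlHash L n A t (idx u) w) 5) (fwlHash L n A t w (idx v))))).symm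
      · exact congrArg Multiset.sum ((hS n B hB x y).msetOf_eq fun w => hashNum (Nat.add (Nat.mul
          (fwlHash L n B t (idx x) w) 5) (fwlHash L n B t w (idx y))))
    refine congrArg (· % colorMod) ?_
    change fwlStep L n A (fwlHash L n A t) (idx u) (idx v)
      = fwlStep L n B (fwlHash L n B t) (idx x) (idx y)
    rw [fwlStep, fwlStep, e0, e2]

theorem pooled_VS_bitColoring (c : ℕ → ℕ → ℕ) : pooled .VS (bitGraph n A hA) (bitColoring c) =
    ((List.range n).map fun u =>
      (((List.range n).map fun v => c u v : List ℕ) : Multiset ℕ) : List (Multiset ℕ)) := by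
  refine Eq.trans ?_ ((enumerates_verts (h := hA)).msetOf_eq fun u =>
    (((List.range n).map fun v => c u v : List ℕ) : Multiset ℕ))
  exact congrArg (msetOf _) (funext fun u => enumerates_verts.msetOf_eq fun v => c (idx u) v)

/-- A numerical invariant of the rows of a colouring. -/
noncomputable def rowInvariant (n : ℕ) (c : ℕ → ℕ → ℕ) : ℕ :=
  sumRange n fun i => hashNum (sumRange n fun j => c i j)

theorem rowInvariant_eq_of_VS {c d : ℕ → ℕ → ℕ}
    (h : pooled .VS (bitGraph n A hA) (bitColoring c)
      = pooled .VS (bitGraph n B hB) (bitColoring d)) :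
    rowInvariant n c = rowInvariant n d := by
  have key : ∀ {A : ℕ} (hA : bitConnected n A) (c : ℕ → ℕ → ℕ), rowInvariant n c =
      ((pooled .VS (bitGraph n A hA) (bitColoring c)).map fun m => hashNum m.sum).sum := by
    intro A hA c
    rw [pooled_VS_bitColoring]
    simp [rowInvariant, sumRange_eq, Function.comp_def]
  rw [key hA, key hB, h]

/-- SV pooling is VS pooling of the transposed colouring. -/
theorem rowInvariant_eq_of_SV {c d : ℕ → ℕ → ℕ}
    (h : pooled .SV (bitGraph n A hA) (bitColoring c)
      = pooled .SV (bitGraph n B hB) (bitColoring d)) :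
    rowInvariant n (fun v u => c u v) = rowInvariant n (fun v u => d u v) :=
  rowInvariant_eq_of_VS (hA := hA) (hB := hB) h

theorem swl_VS_ne {As : List Agg} (t : ℕ)
    (hne : Nat.beq (rowInvariant n (swlHash As n A t))
      (rowInvariant n (swlHash As n B t)) = false) :
    swl As .VS (bitGraph n A hA) ≠ swl As .VS (bitGraph n B hB) := by
  intro h
  rw [swl_eq_pooled, swl_eq_pooled] at h
  exact Nat.ne_of_beq_eq_false hne (rowInvariant_eq_of_VS
    (pooled_congr (fun u v x y e => swlHash_eq t u v x y (congrFun e t)) h))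

theorem swl_SV_ne {As : List Agg} (t : ℕ)
    (hne : Nat.beq (rowInvariant n fun v u => swlHash As n A t u v)
      (rowInvariant n fun v u => swlHash As n B t u v) = false) :
    swl As .SV (bitGraph n A hA) ≠ swl As .SV (bitGraph n B hB) := by
  intro h
  rw [swl_eq_pooled, swl_eq_pooled] at h
  exact Nat.ne_of_beq_eq_false hne (rowInvariant_eq_of_SV
    (pooled_congr (fun u v x y e => swlHash_eq t u v x y (congrFun e t)) h))

theorem pairMset_eq_join {C : Type} (G : FinConnGraph) (χ : G.V → G.V → C) :
    pairMset G χ = (pooled .VS G χ).join := by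
  rw [pairMset, msetOf, Finset.product_val]
  change Multiset.map _ (Multiset.bind _ _) = _
  rw [Multiset.map_bind]
  simp only [Multiset.map_map]
  rfl

/-- The sum of all colours. -/
noncomputable def totalSum (n : ℕ) (c : ℕ → ℕ → ℕ) : ℕ :=
  sumRange n fun i => sumRange n fun j => c i j

theorem totalSum_eq {c d : ℕ → ℕ → ℕ}
    (h : pairMset (bitGraph n A hA) (bitColoring c) = pairMset (bitGraph n B hB) (bitColoring d)) :
    totalSum n c = totalSum n d := by
  have key : ∀ {A : ℕ} (hA : bitConnected n A) (c : ℕ → ℕ → ℕ), totalSum n c =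
      (pairMset (bitGraph n A hA) (bitColoring c)).sum := by
    intro A hA c
    rw [pairMset_eq_join, pooled_VS_bitColoring]
    simp [totalSum, sumRange_eq, Function.comp_def]
  rw [key hA, key hB, h]

theorem fwl_ne {L : ℕ → ℕ → ℕ → ℕ → List ℕ} {S : Range} (hS : EnumeratesRange L S) (t : ℕ)
    (hne : Nat.beq (totalSum n (fwlHash L n A t)) (totalSum n (fwlHash L n B t)) = false) :
    fwl S (bitGraph n A hA) ≠ fwl S (bitGraph n B hB) := fun h =>
  Nat.ne_of_beq_eq_false hne (totalSum_eq
    (pairMset_congr (fun u v x y e => fwlHash_eq hS t u v x y (congrFun e t)) h))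

end HashColorings

/-! ### Exact certificates of stability -/

section Certificates

/-- Every pair passes the test `ok` against the first pair in `reps` with the same colour. -/
noncomputable def checkClasses (n : ℕ) (reps : List (ℕ × ℕ)) (d c : ℕ → ℕ → ℕ)
    (ok : ℕ → ℕ → ℕ × ℕ → Bool) : Bool :=
  allRange n fun u => allRange n fun v =>
    findList reps (fun r => Nat.beq (d r.1 r.2) (c u v)) (ok u v)

theorem exists_of_checkClasses {n : ℕ} {reps : List (ℕ × ℕ)} {d c : ℕ → ℕ → ℕ}
    {ok : ℕ → ℕ → ℕ × ℕ → Bool} (h : checkClasses n reps d c ok) {u v : ℕ} (hu : u < n)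
    (hv : v < n) : ∃ r, (reps.find? fun r => Nat.beq (d r.1 r.2) (c u v)) = some r ∧ ok u v r :=
  findList_iff.1 (allRange_iff.1 (allRange_iff.1 h u hu) v hv)

/-- The rows of two colourings agree up to order. -/
noncomputable def rowsPerm (n : ℕ) (c d : ℕ → ℕ → ℕ) : Bool :=
  allRange n fun u => sameCode (listCode (filterRange n fun _ => true) fun v => c u v)
    (listCode (filterRange n fun _ => true) fun v => d u v)

variable {n A B : ℕ} {hA : bitConnected n A} {hB : bitConnected n B}

/-- Comparing row `u` with row `u` is sufficient but not necessary; it works when the vertices of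
the two graphs are numbered compatibly. -/
theorem pooled_VS_of_rowsPerm {c d : ℕ → ℕ → ℕ} (h : rowsPerm n c d) :
    pooled .VS (bitGraph n A hA) (bitColoring c) = pooled .VS (bitGraph n B hB) (bitColoring d) := by
  rw [pooled_VS_bitColoring, pooled_VS_bitColoring]
  refine congrArg _ (List.map_congr_left fun u hu => Multiset.coe_eq_coe.2 ?_)
  have hp := filterRange_perm n fun _ => true
  rw [List.filter_true] at hp
  exact ((hp.map _).symm.trans (perm_of_sameCode (allRange_iff.1 h u (List.mem_range.1 hu)))).trans
    (hp.map _)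

theorem pooled_SV_of_rowsPerm {c d : ℕ → ℕ → ℕ}
    (h : rowsPerm n (fun v u => c u v) fun v u => d u v) :
    pooled .SV (bitGraph n A hA) (bitColoring c) = pooled .SV (bitGraph n B hB) (bitColoring d) :=
  pooled_VS_of_rowsPerm (hA := hA) (hB := hB) h

theorem pairMset_of_rowsPerm {c d : ℕ → ℕ → ℕ} (h : rowsPerm n c d) :
    pairMset (bitGraph n A hA) (bitColoring c) = pairMset (bitGraph n B hB) (bitColoring d) := by
  rw [pairMset_eq_join, pairMset_eq_join, pooled_VS_of_rowsPerm (hA := hA) (hB := hB) h]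

noncomputable def swlOk (As : List Agg) (n A B : ℕ) (c d : ℕ → ℕ → ℕ) (u v : ℕ) (r : ℕ × ℕ) :
    Bool :=
  cond (Nat.beq (cond (Nat.beq u v) 1 0) (cond (Nat.beq r.1 r.2) 1 0))
    (allList As fun a => sameCode (aggFold listCode n A c r.1 r.2 a) (aggFold listCode n B d u v a))
    false

theorem swlOk_iff {As : List Agg} {c d : ℕ → ℕ → ℕ} {u v : (bitGraph n B hB).V} {r : ℕ × ℕ}
    (h : swlOk As n A B c d (idx u) (idx v) r) :
    nodeMark (bitGraph n B hB) u v = cond (Nat.beq r.1 r.2) 1 0 ∧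
      ∀ a ∈ As, a.eval (bitGraph n B hB) (bitColoring d) u v =
        ((aggSupport n A r.1 r.2 a).map (aggValue c r.1 r.2 a) : List ℕ) := by
  rw [swlOk, Bool.cond_false_right, Bool.and_eq_true, Nat.beq_eq, ← nodeMark_bitGraph,
    allList_iff] at h
  refine ⟨h.1, fun a ha => ?_⟩
  have h2 := h.2 a ha
  rw [aggFold_eq, aggFold_eq] at h2
  rw [eval_bitColoring]
  exact (Multiset.coe_eq_coe.2 (perm_of_sameCode h2)).symm

/-- A check that two colourings are stable under an SWL refinement step. -/
noncomputable def swlCheck (As : List Agg) (n A B : ℕ) (reps : List (ℕ × ℕ)) (c d : ℕ → ℕ → ℕ) :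
    Bool :=
  cond (checkClasses n reps c c (swlOk As n A A c c))
    (checkClasses n reps c d (swlOk As n A B c d)) false

/-- Two pairs of the same colour find the same representative in `reps`, and both have been compared
with it. One comparison per pair thus replaces a comparison of all pairs with each other. -/
theorem swlStable_of_check {As : List Agg} {reps : List (ℕ × ℕ)} {c d : ℕ → ℕ → ℕ}
    (h : swlCheck As n A B reps c d) :
    SwlStable As (bitGraph n A hA) (bitGraph n B hB) (bitColoring c) (bitColoring d) := by
  rw [swlCheck, Bool.cond_false_right, Bool.and_eq_true] at h
  intro u v x y e
  obtain ⟨r, hr, ok1⟩ := exists_of_checkClasses h.1 (idx_lt u) (idx_lt v)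
  obtain ⟨r', hr', ok2⟩ := exists_of_checkClasses h.2 (idx_lt x) (idx_lt y)
  have e' : c (idx u) (idx v) = d (idx x) (idx y) := e
  rw [← e', hr] at hr'
  cases hr'
  exact ⟨(swlOk_iff ok1).1.trans (swlOk_iff ok2).1.symm,
    fun a ha => ((swlOk_iff ok1).2 a ha).trans ((swlOk_iff ok2).2 a ha).symm⟩

noncomputable def fwlOk (L : ℕ → ℕ → ℕ → ℕ → List ℕ) (n A B : ℕ) (c d : ℕ → ℕ → ℕ) (u v : ℕ)
    (r : ℕ × ℕ) : Bool :=
  cond (Nat.beq (bitIsoType n B u v) (bitIsoType n A r.1 r.2))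
    (sameCode (listCode (L n A r.1 r.2) (walkValue c r.1 r.2))
      (listCode (L n B u v) (walkValue d u v))) false

theorem fwlOk_iff {L : ℕ → ℕ → ℕ → ℕ → List ℕ} {S : Range} (hS : EnumeratesRange L S)
    {c d : ℕ → ℕ → ℕ} {u v : (bitGraph n B hB).V} {r : ℕ × ℕ}
    (h : fwlOk L n A B c d (idx u) (idx v) r) :
    isoType (bitGraph n B hB) u v = bitIsoType n A r.1 r.2 ∧
      (walk (bitGraph n B hB) u v (S _ u v) (bitColoring d)).map (fun p => p.1 * 64 + p.2)
        = ((L n A r.1 r.2).map (walkValue c r.1 r.2) : List ℕ) := by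
  rw [fwlOk, Bool.cond_false_right, Bool.and_eq_true, Nat.beq_eq, ← isoType_bitGraph] at h
  refine ⟨h.1, ?_⟩
  rw [walk_map_eq hS]
  exact (Multiset.coe_eq_coe.2 (perm_of_sameCode h.2)).symm

/-- A check that two colourings are stable under a folklore-type refinement step. -/
noncomputable def fwlCheck (L : ℕ → ℕ → ℕ → ℕ → List ℕ) (n A B : ℕ) (reps : List (ℕ × ℕ))
    (c d : ℕ → ℕ → ℕ) : Bool :=
  cond (checkClasses n reps c c (fwlOk L n A A c c))
    (checkClasses n reps c d (fwlOk L n A B c d)) false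

theorem fwlStable_of_check {L : ℕ → ℕ → ℕ → ℕ → List ℕ} {S : Range} (hS : EnumeratesRange L S)
    {reps : List (ℕ × ℕ)} {c d : ℕ → ℕ → ℕ} (hc : ∀ i j, c i j < 64)
    (hd : ∀ i j, d i j < 64) (h : fwlCheck L n A B reps c d) :
    FwlStable S (bitGraph n A hA) (bitGraph n B hB) (bitColoring c) (bitColoring d) := by
  rw [fwlCheck, Bool.cond_false_right, Bool.and_eq_true] at h
  intro u v x y e
  obtain ⟨r, hr, ok1⟩ := exists_of_checkClasses h.1 (idx_lt u) (idx_lt v)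
  obtain ⟨r', hr', ok2⟩ := exists_of_checkClasses h.2 (idx_lt x) (idx_lt y)
  have e' : c (idx u) (idx v) = d (idx x) (idx y) := e
  rw [← e', hr] at hr'
  cases hr'
  refine ⟨(fwlOk_iff hS ok1).1.trans (fwlOk_iff hS ok2).1.symm, ?_⟩
  have h1 := (fwlOk_iff hS ok1).2.trans (fwlOk_iff hS ok2).2.symm
  rw [walk, walk, msetOf, msetOf, Multiset.map_map, Multiset.map_map] at h1
  refine msetOf_congr (f := (fun p : ℕ × ℕ => p.1 * 64 + p.2) ∘ _)
    (g := (fun p : ℕ × ℕ => p.1 * 64 + p.2) ∘ _) h1 fun w _ z _ hwz => ?_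
  -- Second entries below 64 make the packing `p.1 * 64 + p.2` of colour pairs injective.
  have hw := hc (idx w) (idx v)
  have hz := hd (idx z) (idx y)
  simp only [Function.comp_apply, bitColoring, Prod.mk.injEq] at hwz ⊢
  omega

end Certificates

/-! ### Equality of outputs from a guessed partition -/

section Separation

/-- The colouring by the position in `reps` of the first pair with the same colour under `d`. -/
noncomputable def classColor (n : ℕ) (reps : List (ℕ × ℕ)) (d c : ℕ → ℕ → ℕ) (u v : ℕ) : ℕ :=
  Nat.mod (lookup n (tabulate n fun i j => indexList reps fun r => Nat.beq (d r.1 r.2) (c i j)) u v)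
    64

noncomputable def swlClass (As : List Agg) (n A B t : ℕ) (reps : List (ℕ × ℕ)) : ℕ → ℕ → ℕ :=
  classColor n reps (swlHash As n A t) (swlHash As n B t)

noncomputable def fwlClass (L : ℕ → ℕ → ℕ → ℕ → List ℕ) (n A B t : ℕ) (reps : List (ℕ × ℕ)) :
    ℕ → ℕ → ℕ :=
  classColor n reps (fwlHash L n A t) (fwlHash L n B t)

variable {n A B : ℕ} {hA : bitConnected n A} {hB : bitConnected n B}

/-- The classes of the hash colourings of two graphs after `t` rounds are stable and have the same rows. -/
noncomputable def swlIndistinct (As : List Agg) (n A B t : ℕ) (reps : List (ℕ × ℕ)) : Bool :=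
  cond (swlCheck As n A B reps (swlClass As n A A t reps) (swlClass As n A B t reps))
    (rowsPerm n (swlClass As n A A t reps) (swlClass As n A B t reps)) false

/-- The classes of the hash colourings of two graphs after `t` rounds are stable and have the same columns. -/
noncomputable def swlIndistinctSV (As : List Agg) (n A B t : ℕ) (reps : List (ℕ × ℕ)) : Bool :=
  cond (swlCheck As n A B reps (swlClass As n A A t reps) (swlClass As n A B t reps))
    (rowsPerm n (fun v u => swlClass As n A A t reps u v) fun v u => swlClass As n A B t reps u v) false

/-- The classes of the hash colourings of two graphs after `t` rounds are stable and have the same rows. -/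
noncomputable def fwlIndistinct (L : ℕ → ℕ → ℕ → ℕ → List ℕ) (n A B t : ℕ) (reps : List (ℕ × ℕ)) :
    Bool :=
  cond (fwlCheck L n A B reps (fwlClass L n A A t reps) (fwlClass L n A B t reps))
    (rowsPerm n (fwlClass L n A A t reps) (fwlClass L n A B t reps)) false

theorem swl_VS_eq {As : List Agg} (t : ℕ) (reps : List (ℕ × ℕ))
    (h : swlIndistinct As n A B t reps) :
    swl As .VS (bitGraph n A hA) = swl As .VS (bitGraph n B hB) := by
  rw [swlIndistinct, Bool.cond_false_right, Bool.and_eq_true] at h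
  exact swl_eq_of_swlStable (swlStable_of_check h.1) (pooled_VS_of_rowsPerm h.2)

theorem swl_SV_eq {As : List Agg} (t : ℕ) (reps : List (ℕ × ℕ))
    (h : swlIndistinctSV As n A B t reps) :
    swl As .SV (bitGraph n A hA) = swl As .SV (bitGraph n B hB) := by
  rw [swlIndistinctSV, Bool.cond_false_right, Bool.and_eq_true] at h
  exact swl_eq_of_swlStable (swlStable_of_check h.1) (pooled_SV_of_rowsPerm h.2)

theorem fwl_eq {L : ℕ → ℕ → ℕ → ℕ → List ℕ} {S : Range} (hS : EnumeratesRange L S) (t : ℕ)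
    (reps : List (ℕ × ℕ)) (h : fwlIndistinct L n A B t reps) :
    fwl S (bitGraph n A hA) = fwl S (bitGraph n B hB) := by
  rw [fwlIndistinct, Bool.cond_false_right, Bool.and_eq_true] at h
  exact fwl_eq_of_fwlStable (fwlStable_of_check hS (fun _ _ => Nat.mod_lt _ (by norm_num))
    (fun _ _ => Nat.mod_lt _ (by norm_num)) h.1) (pairMset_of_rowsPerm h.2)

end Separation

/-! ### The six separating pairs of Fürer graphs -/

/-- The edges of the Fürer graph over the base graph with the edges 01, 02, 03, 12, 14, 15, 23,
36, 37, 45, 67. -/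
def furer_PSWL_VS_SWL_SV : ℕ :=
  0x20f00000100f000000cc00000033000002001e000100019800001980000006180000c044000020230000c021000020460000c021000020460000c044000020230000151500000ae80000157000000024000000430000004100000026000000410000002600000008000000100000000400000003000000020000000100000000

/-- The edges of the Fürer graph twisted along one edge of the base graph. -/
def twisted_PSWL_VS_SWL_SV : ℕ :=
  0x20f00000100f000000cc00000033000002001e000100019800001980000006180000c044000020230000c021000020460000c021000020460000c044000020230000151500000ae80000157000000041000000260000002400000043000000240000004300000010000000080000000100000006000000020000000100000000

/-- Representatives of the stable colour classes of `SWL`. -/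
def reps_PSWL_VS_SWL_SV : List (ℕ × ℕ) :=
  [(0, 0), (0, 1), (0, 2), (0, 3), (0, 4), (0, 5), (0, 24), (3, 0), (3, 2), (3, 3), (3, 4),
   (3, 7), (3, 11), (3, 12), (3, 16), (3, 24), (3, 25), (3, 28), (7, 0), (7, 1), (7, 3), (7, 7),
   (7, 8), (7, 9), (7, 10), (7, 16), (7, 24), (7, 25), (7, 28), (24, 0), (24, 3), (24, 7),
   (24, 9), (24, 11), (24, 16), (24, 24), (24, 25), (24, 26), (24, 27), (24, 28)]

/-- This pair shows that `Pvv` adds power under either pooling, and that SV pooling cannot make up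
for its absence. -/
theorem not_PSWL_VS_SWL_SV :
    ¬ WeakerEq (PSWL .VS) (SWL .SV) := by
  have hA : bitConnected 32 furer_PSWL_VS_SWL_SV := by decide +kernel
  have hB : bitConnected 32 twisted_PSWL_VS_SWL_SV := by decide +kernel
  -- The hash partition after 6 rounds passes the stability check; for the other test, the hash
  -- invariants already differ after 5 rounds.
  have hc : swlIndistinctSV [.Lu] 32 furer_PSWL_VS_SWL_SV twisted_PSWL_VS_SWL_SV 6
      reps_PSWL_VS_SWL_SV := by decide +kernel
  have hn : Nat.beq (rowInvariant 32 (swlHash [.Lu, .Pvv] 32 furer_PSWL_VS_SWL_SV 5))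
      (rowInvariant 32 (swlHash [.Lu, .Pvv] 32 twisted_PSWL_VS_SWL_SV 5)) = false := by
    decide +kernel
  exact fun h => swl_VS_ne 5 hn
    (h (bitGraph _ _ hA) (bitGraph _ _ hB) (swl_SV_eq 6 _ hc))

/-- The edges of the Fürer graph over the base graph with the edges 01, 02, 03, 06, 12, 24, 25,
36, 38, 45, 47, 57, 68. -/
def furer_GSWL_PSWL_SV : ℕ :=
  0xc00c000000c00c000000cc00000000cc000000000a006140001406180000a01860000140185000a00e00800143c000000a0f0000001403802000003200800003300000000cc00000000c8020000000a2400000051400000014500000002890000001f0000000003d00000001740000007a000000001740000007a00000001f000000000400000000080000000020000000010000000000c000000004c00000000200000000080000000020000000004000000000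

/-- The edges of the Fürer graph twisted along one edge of the base graph. -/
def twisted_GSWL_PSWL_SV : ℕ :=
  0xc00c000000c00c000000cc00000000cc000000000a006140001406180000a01860000140185000a00e00800143c000000a0f0000001403802000003200800003300000000cc00000000c8020000000a2400000051400000014500000002890000001f0000000003d00000001740000007a000000001740000007a00000001f0000000002000000001000000000400000000080000000011000000003800000000200000000080000000020000000004000000000

/-- Representatives of the stable colour classes of `PSWL`. -/
def reps_GSWL_PSWL_SV : List (ℕ × ℕ) :=
  [(0, 0), (0, 1), (0, 2), (0, 4), (0, 5), (0, 6), (0, 7), (0, 8), (0, 10), (0, 11), (0, 12),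
   (0, 13), (0, 18), (0, 19), (0, 22), (0, 34), (0, 36), (5, 0), (5, 2), (5, 5), (5, 6), (5, 18),
   (5, 34), (18, 0), (18, 1), (18, 2), (18, 3), (18, 4), (18, 5), (18, 18), (18, 19), (18, 20),
   (18, 21), (18, 22), (18, 30), (18, 31), (18, 32), (18, 33), (18, 34), (18, 36), (18, 37),
   (34, 0), (34, 1), (34, 5), (34, 18), (34, 22), (34, 24), (34, 34), (34, 35), (34, 36)]

theorem not_GSWL_PSWL_SV :
    ¬ WeakerEq GSWL (PSWL .SV) := by
  have hA : bitConnected 38 furer_GSWL_PSWL_SV := by decide +kernel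
  have hB : bitConnected 38 twisted_GSWL_PSWL_SV := by decide +kernel
  have hc : swlIndistinctSV [.Lu, .Pvv] 38 furer_GSWL_PSWL_SV twisted_GSWL_PSWL_SV 4
      reps_GSWL_PSWL_SV := by decide +kernel
  have hn : Nat.beq (rowInvariant 38 (swlHash [.Lu, .Gv] 38 furer_GSWL_PSWL_SV 5))
      (rowInvariant 38 (swlHash [.Lu, .Gv] 38 twisted_GSWL_PSWL_SV 5)) = false := by
    decide +kernel
  exact fun h => swl_VS_ne 5 hn
    (h (bitGraph _ _ hA) (bitGraph _ _ hB) (swl_SV_eq 4 _ hc))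

/-- The edges of the Fürer graph over the base graph with the edges 01, 02, 04, 13, 15, 23, 24,
35. -/
def furer_SSWL_GSWL : ℕ :=
  0xc1800301800c440022300a880051200b100048a000050006000060000410002400008000100000400001000020000100000

/-- The edges of the Fürer graph twisted along one edge of the base graph. -/
def twisted_SSWL_GSWL : ℕ :=
  0xc1800301800c440022300a880051200b100048a000050006000060000240004100010000080000100004000020000100000

/-- Representatives of the stable colour classes of `GSWL`. -/
def reps_SSWL_GSWL : List (ℕ × ℕ) :=
  [(0, 0), (0, 1), (0, 2), (0, 3), (0, 4), (0, 5), (0, 6), (0, 9), (0, 16), (0, 17), (16, 0),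
   (16, 2), (16, 16), (16, 17)]

theorem not_SSWL_GSWL :
    ¬ WeakerEq SSWL GSWL := by
  have hA : bitConnected 20 furer_SSWL_GSWL := by decide +kernel
  have hB : bitConnected 20 twisted_SSWL_GSWL := by decide +kernel
  have hc : swlIndistinct [.Lu, .Gv] 20 furer_SSWL_GSWL twisted_SSWL_GSWL 3
      reps_SSWL_GSWL := by decide +kernel
  have hn : Nat.beq (rowInvariant 20 (swlHash [.Lu, .Lv] 20 furer_SSWL_GSWL 4))
      (rowInvariant 20 (swlHash [.Lu, .Lv] 20 twisted_SSWL_GSWL 4)) = false := by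
    decide +kernel
  exact fun h => swl_VS_ne 4 hn
    (h (bitGraph _ _ hA) (bitGraph _ _ hB) (swl_VS_eq 3 _ hc))

/-- The edges of the Fürer graph over the base graph with the edges 01, 02, 03, 04, 12, 13, 15,
34, 35. -/
def furer_LFWL2_SSWL : ℕ :=
  0xf07800003c18600cc018600cc01850006745000062e900066a24000657400066a2400065740006745000062e900055f00000048c00000c4c000031100001238000031100001238000004000000080000002000000100000000c0000004c0000002000000080000002000000040000000

/-- The edges of the Fürer graph twisted along one edge of the base graph. -/
def twisted_LFWL2_SSWL : ℕ :=
  0xf07800003c18600cc018600cc01850006745000062e900066a24000657400066a2400065740006745000062e900055f00000031100001238000048c00000c4c000048c00000c4c0000020000001000000040000000800000011000000380000002000000080000002000000040000000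

/-- Representatives of the stable colour classes of `SSWL`. -/
def reps_LFWL2_SSWL : List (ℕ × ℕ) :=
  [(0, 0), (0, 1), (0, 2), (0, 3), (0, 5), (0, 6), (0, 9), (0, 10), (0, 11), (0, 12), (0, 17),
   (0, 28), (1, 0), (1, 1), (1, 6), (1, 17), (1, 18), (1, 26)]

/-- This also makes `LFWL2` strictly stronger than `PSWL .VS`, and `SLFWL2` strictly stronger than
`SSWL`. -/
theorem not_LFWL2_SSWL :
    ¬ WeakerEq LFWL2 SSWL := by
  have hA : bitConnected 30 furer_LFWL2_SSWL := by decide +kernel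
  have hB : bitConnected 30 twisted_LFWL2_SSWL := by decide +kernel
  have hc : swlIndistinct [.Lu, .Lv] 30 furer_LFWL2_SSWL twisted_LFWL2_SSWL 3
      reps_LFWL2_SSWL := by decide +kernel
  have hn : Nat.beq (totalSum 30 (fwlHash rangeLFWL2 30 furer_LFWL2_SSWL 4))
      (totalSum 30 (fwlHash rangeLFWL2 30 twisted_LFWL2_SSWL 4)) = false := by
    decide +kernel
  exact fun h => fwl_ne enumeratesRange_LFWL2 4 hn
    (h (bitGraph _ _ hA) (bitGraph _ _ hB) (swl_VS_eq 3 _ hc))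

/-- The edges of the Fürer graph over the base graph with the edges 0-4, 1-4, 0-2, 0-5, 5-6,
3-6, 1-2, 1-3, 7-11, 8-11, 7-9, 7-12, 12-13, 10-13, 8-9, 8-10, 6-13. -/
def furer_SWL_SV_LFWL2 : ℕ :=
  0x9000c000010002c0000110003000000440000000022100000002c80000000c2400000008800000000100000000010000000001000000000008000000001000000000100000000010000000000400000000020000000002000000000100000000003000000000048000000008020000000880000000040200000000204000000010100000001540000000609000000041000000000800000000080000000008000000000400000000020000000000800000000020000000002000000000200000000010000000000

/-- The edges of the Fürer graph twisted along one edge of the base graph. -/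
def twisted_SWL_SV_LFWL2 : ℕ :=
  0x9000c000010002c0000110003000000440000000022100000002c80000000c240000000880000000010000000001000000000100000000000800000000100000000010000000001000000000040000000002000000000200000000010000000000300000000004800000000802000000088000000004020000000020400000001010000000251000000050c000000041000000000800000000080000000008000000000400000000020000000000800000000020000000002000000000200000000010000000000

/-- Representatives of the stable colour classes of `LFWL2`. -/
def reps_SWL_SV_LFWL2 : List (ℕ × ℕ) :=
  [(0, 0), (0, 1), (0, 2), (0, 3), (0, 4), (0, 5), (0, 6), (0, 7), (0, 8), (0, 11), (0, 14),
   (0, 15), (0, 16), (0, 17), (0, 18), (0, 19), (0, 20), (0, 21), (0, 22), (0, 24), (0, 38),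
   (1, 0), (1, 1), (1, 5), (1, 6), (1, 7), (1, 12), (1, 16), (1, 20), (1, 21), (1, 22), (1, 24),
   (5, 0), (5, 1), (5, 3), (5, 4), (5, 5), (5, 11), (5, 14), (5, 16), (5, 17), (5, 20), (5, 21),
   (5, 22), (5, 24), (16, 0), (16, 1), (16, 2), (16, 5), (16, 11), (16, 16), (16, 17), (16, 18),
   (16, 20), (16, 21), (16, 22), (16, 24), (16, 38)]

/-- The base graph consists of two copies of a graph on seven vertices, joined by the edge 6-13. As
`LFWL2` lies above both VS tests and `SLFWL2` lies above `SWL .SV`, this pair also shows that SV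
pooling and symmetrization add power. -/
theorem not_SWL_SV_LFWL2 :
    ¬ WeakerEq (SWL .SV) LFWL2 := by
  have hA : bitConnected 40 furer_SWL_SV_LFWL2 := by decide +kernel
  have hB : bitConnected 40 twisted_SWL_SV_LFWL2 := by decide +kernel
  have hc : fwlIndistinct rangeLFWL2 40 furer_SWL_SV_LFWL2 twisted_SWL_SV_LFWL2 5
      reps_SWL_SV_LFWL2 := by decide +kernel
  have hn : Nat.beq (rowInvariant 40 fun v u => swlHash [.Lu] 40 furer_SWL_SV_LFWL2 6 u v)
      (rowInvariant 40 fun v u => swlHash [.Lu] 40 twisted_SWL_SV_LFWL2 6 u v) = false := by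
    decide +kernel
  exact fun h => swl_SV_ne 6 hn
    (h (bitGraph _ _ hA) (bitGraph _ _ hB) (fwl_eq enumeratesRange_LFWL2 5 _ hc))

/-- The edges of the Fürer graph over the base graph with the edges 01, 06, 62, 07, 73, 04, 18,
82, 29, 93, 25, 34, 35. -/
def furer_FWL2_SLFWL2 : ℕ :=
  0xc629400000c65280000a5000100014a00020000024d860000064985009300145001920028900080000000020000000008000000002000000000031800000010000000004000000001000000000400000000031800000002000000000800000000200000000080000000001e00000000002000000000800000000200000000080000000400000000080000000020000000010000000000c000000004400000000200000000080000000020000000004000000000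

/-- The edges of the Fürer graph twisted along one edge of the base graph. -/
def twisted_FWL2_SLFWL2 : ℕ :=
  0xc629400000c65280000a5000100014a00020000024d860000064985009300145001920028900080000000020000000008000000002000000000031800000010000000004000000001000000000400000000031800000002000000000800000000200000000080000000001e000000000020000000008000000002000000000800000002000000001000000000400000000080000000011000000003000000000200000000080000000020000000004000000000

/-- Representatives of the stable colour classes of `SLFWL2`. -/
def reps_FWL2_SLFWL2 : List (ℕ × ℕ) :=
  [(0, 0), (0, 1), (0, 2), (0, 3), (0, 4), (0, 5), (0, 6), (0, 9), (0, 10), (0, 11), (0, 12),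
   (0, 15), (0, 16), (0, 20), (0, 21), (0, 22), (0, 23), (0, 24), (0, 30), (0, 31), (0, 34),
   (0, 35), (1, 0), (1, 1), (1, 5), (1, 7), (1, 11), (1, 15), (1, 16), (1, 20), (1, 21), (1, 30),
   (1, 32), (1, 34), (5, 0), (5, 1), (5, 2), (5, 5), (5, 6), (5, 11), (5, 20), (5, 21), (5, 22),
   (5, 30), (5, 34), (5, 35), (11, 0), (11, 1), (11, 3), (11, 5), (11, 9), (11, 11), (11, 12),
   (11, 15), (11, 19), (11, 30), (30, 0), (30, 1), (30, 2), (30, 5), (30, 11), (30, 30), (30, 31)]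

theorem not_FWL2_SLFWL2 :
    ¬ WeakerEq FWL2 SLFWL2 := by
  have hA : bitConnected 38 furer_FWL2_SLFWL2 := by decide +kernel
  have hB : bitConnected 38 twisted_FWL2_SLFWL2 := by decide +kernel
  have hc : fwlIndistinct rangeSLFWL2 38 furer_FWL2_SLFWL2 twisted_FWL2_SLFWL2 3
      reps_FWL2_SLFWL2 := by decide +kernel
  have hn : Nat.beq (totalSum 38 (fwlHash rangeFWL2 38 furer_FWL2_SLFWL2 2))
      (totalSum 38 (fwlHash rangeFWL2 38 twisted_FWL2_SLFWL2 2)) = false := by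
    decide +kernel
  exact fun h => fwl_ne enumeratesRange_FWL2 2 hn
    (h (bitGraph _ _ hA) (bitGraph _ _ hB) (fwl_eq enumeratesRange_SLFWL2 3 _ hc))


/-! ### Assembling the hierarchy -/

section Transitivity

variable {R₁ R₂ R₃ : Type} {c₁ : FinConnGraph → R₁} {c₂ : FinConnGraph → R₂}
  {c₃ : FinConnGraph → R₃}

theorem WeakerEq.trans (h : WeakerEq c₃ c₂) (h' : WeakerEq c₂ c₁) : WeakerEq c₃ c₁ :=
  fun G H e => h G H (h' G H e)

theorem WeakerEq.strictlyWeaker (h : WeakerEq c₂ c₁) (hn : ¬ WeakerEq c₁ c₂) :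
    StrictlyWeaker c₂ c₁ :=
  ⟨h, fun h' => hn h'.2⟩

end Transitivity

theorem SWL_weakerEq_PSWL (P : Pool) : WeakerEq (SWL P) (PSWL P) :=
  swl_weakerEq_of_subset (by simp) P

theorem SWL_VS_weakerEq_SWL_SV : WeakerEq (SWL .VS) (SWL .SV) :=
  swl_VS_weakerEq_swl_SV (by simp)

theorem PSWL_VS_weakerEq_PSWL_SV : WeakerEq (PSWL .VS) (PSWL .SV) :=
  swl_VS_weakerEq_swl_SV (by simp)

theorem PSWL_SV_weakerEq_SSWL : WeakerEq (PSWL .SV) SSWL :=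
  PSWL_SV_weakerEq_GSWL.trans GSWL_weakerEq_SSWL

/-- A test between `SWL .SV` and `SSWL` is incomparable with `LFWL2`. -/
theorem incomparable_LFWL2 {R : Type} {c : FinConnGraph → R} (h : WeakerEq (SWL .SV) c)
    (h' : WeakerEq c SSWL) : Incomparable LFWL2 c :=
  ⟨fun e => not_LFWL2_SSWL (e.trans h'), fun e => not_SWL_SV_LFWL2 (h.trans e)⟩

end WLHierarchy

open WLHierarchy

theorem theorem7p1 :
    (WLHierarchy.StrictlyWeaker (WLHierarchy.SWL .VS) (WLHierarchy.SWL .SV) ∧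
      WLHierarchy.StrictlyWeaker (WLHierarchy.PSWL .VS) (WLHierarchy.PSWL .SV)) ∧
    (WLHierarchy.StrictlyWeaker (WLHierarchy.SWL .VS) (WLHierarchy.PSWL .VS) ∧
      WLHierarchy.StrictlyWeaker (WLHierarchy.SWL .SV) (WLHierarchy.PSWL .SV)) ∧
    (WLHierarchy.StrictlyWeaker (WLHierarchy.PSWL .SV) WLHierarchy.GSWL ∧
      WLHierarchy.StrictlyWeaker WLHierarchy.GSWL WLHierarchy.SSWL) ∧
    (WLHierarchy.StrictlyWeaker (WLHierarchy.PSWL .VS) WLHierarchy.LFWL2 ∧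
      WLHierarchy.StrictlyWeaker WLHierarchy.SSWL WLHierarchy.SLFWL2) ∧
    (WLHierarchy.StrictlyWeaker WLHierarchy.LFWL2 WLHierarchy.SLFWL2 ∧
      WLHierarchy.StrictlyWeaker WLHierarchy.SLFWL2 WLHierarchy.FWL2) ∧
    WLHierarchy.Incomparable (WLHierarchy.SWL .SV) (WLHierarchy.PSWL .VS) ∧
    (WLHierarchy.Incomparable WLHierarchy.LFWL2 (WLHierarchy.SWL .SV) ∧
      WLHierarchy.Incomparable WLHierarchy.LFWL2 (WLHierarchy.PSWL .SV) ∧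
      WLHierarchy.Incomparable WLHierarchy.LFWL2 WLHierarchy.GSWL ∧
      WLHierarchy.Incomparable WLHierarchy.LFWL2 WLHierarchy.SSWL) := by
  have hSP := SWL_weakerEq_PSWL .SV
  have hG := hSP.trans PSWL_SV_weakerEq_GSWL
  have hS := hG.trans GSWL_weakerEq_SSWL
  refine ⟨⟨SWL_VS_weakerEq_SWL_SV.strictlyWeaker fun h => ?_,
      PSWL_VS_weakerEq_PSWL_SV.strictlyWeaker fun h => ?_⟩,
    ⟨(SWL_weakerEq_PSWL .VS).strictlyWeaker fun h => ?_, hSP.strictlyWeaker fun h => ?_⟩,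
    ⟨PSWL_SV_weakerEq_GSWL.strictlyWeaker not_GSWL_PSWL_SV,
      GSWL_weakerEq_SSWL.strictlyWeaker not_SSWL_GSWL⟩,
    ⟨PSWL_VS_weakerEq_LFWL2.strictlyWeaker fun h => ?_,
      SSWL_weakerEq_SLFWL2.strictlyWeaker fun h => ?_⟩,
    ⟨LFWL2_weakerEq_SLFWL2.strictlyWeaker fun h => ?_,
      SLFWL2_weakerEq_FWL2.strictlyWeaker not_FWL2_SLFWL2⟩,
    ⟨fun h => not_SWL_SV_LFWL2 (h.trans PSWL_VS_weakerEq_LFWL2), not_PSWL_VS_SWL_SV⟩,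
    incomparable_LFWL2 (fun _ _ => id) hS, incomparable_LFWL2 hSP PSWL_SV_weakerEq_SSWL,
    incomparable_LFWL2 hG GSWL_weakerEq_SSWL, incomparable_LFWL2 hS fun _ _ => id⟩
  -- Each remaining converse, composed with comparisons already proved, would contradict one of the
  -- six separations.
  · exact not_SWL_SV_LFWL2 ((h.trans (SWL_weakerEq_PSWL .VS)).trans PSWL_VS_weakerEq_LFWL2)
  · exact not_SWL_SV_LFWL2 ((hSP.trans h).trans PSWL_VS_weakerEq_LFWL2)
  · exact not_PSWL_VS_SWL_SV (h.trans SWL_VS_weakerEq_SWL_SV)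
  · exact not_PSWL_VS_SWL_SV (PSWL_VS_weakerEq_PSWL_SV.trans h)
  · exact not_LFWL2_SSWL (h.trans (PSWL_VS_weakerEq_PSWL_SV.trans PSWL_SV_weakerEq_SSWL))
  · exact not_LFWL2_SSWL (LFWL2_weakerEq_SLFWL2.trans h)
  · exact not_SWL_SV_LFWL2 ((hS.trans SSWL_weakerEq_SLFWL2).trans h)
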